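/- **Setting.** Let $\mathcal G$ be a graph on a finite set of nodes, $\mathcal Q$ a finite collection of connected subgraphs of $\mathcal G$, $D(\mathcal F)=\max(1,\operatorname{diam}\mathcal F)$ for $\mathcal F\in\mathcal Q$ (diameter inside $\mathcal F$), and $D_{\mathcal Q}=\max_{\mathcal F\in\mathcal Q}D(\mathcal F)$. Let $d\ge 1$, $G>0$, and let $b$ be the number of bits that a node may send per round, with $b\ge D_{\mathcal Q}(3\lceil\log_2 d\rceil+2)$. Put $k=\lfloor b/D_{\mathcal Q}\rfloor$, $p=\lceil\log_2 d\rceil$, $m=\lfloor k/(3\lceil\log_2 d\rceil+2)\rfloor$. In each round $t=1,\dots,T$ an adversary, who knows all messages of the earlier rounds, chooses the active node $I_t$ and a convex loss $\ell_t:\mathbb R^d\to\mathbb R$; node $I_t$ plays $w_t\in\mathbb R^d$ and observes a subgradient $g_t$ of $\ell_t$ at $w_t$ with $\|g_t\|\le G$ (Euclidean norm). It then encodes $g_t$ by *sparsified quantization*: independently $m$ times, it draws a coordinate $i$ uniformly, truncates $|(g_t)_i|/G$ to $p$ binary digits (the value $1$ being read as $0.11\ldots$), giving $c\,2^{-p}$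 with $c\in\{0,\dots,2^p-1\}$, and draws a bit $\beta\in\{0,1\}$ with $P(\beta=1)=2^p|(g_t)_i|/G-c$; it transmits $i$, the sign, $c$ and $\beta$. The decoded vector $\hat g_t$ is the average of the $m$ vectors $d\,\operatorname{sign}((g_t)_i)\,2^{-p}G(c+\beta)\,e_i$. Messages travel one edge per round and are discarded when older than $D_{\mathcal Q}$ rounds. **Algorithm.** For $\mathcal F\in\mathcal Q$ and a round $t$ with $I_t\in\mathcal F$, let $S(t)$ be the set of rounds $s<t$ with $I_s\in\mathcal F$ and $s+\operatorname{dist}_{\mathcal F}(I_s,I_t)\le t$, and $\gamma(t)$ the set of the other rounds $s<t$ with $I_s\in\mathcal F$. Let $B=2dG$, $\nu=1/|\mathcal Q|$, $a=(20B(1+2D(\mathcal F)))^{-1}$. The copy of the algorithm on $\mathcal F$ predicts $w_t^{\mathcal F}=v_tz_t$. The direction $z_t$ (AdaDelay-Dist) is the projection onto the unit ball of $-\eta_t\sum_{s\in S(t)}\hat g_s$ with $$\eta_t=\Big(\sum_{s\in S(t)}\big(\|\hat g_s\|^2+2\|\hat g_s\|\!\!\sum_{i\in\gamma(s)\cap S(t)}\!\!\|\hat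 g_i\|\big)+B^2(2D(\mathcal F)+1)^2\Big)^{-1/2}.$$ With $\hat h_s=\langle z_s,\hat g_s\rangle$ the scale is $$v_t=\frac{\int_0^a \nu\,\eta\,\exp\!\big(-\sum_{s\in S(t)}(\eta\hat h_s+\eta^2\hat h_s^2+2\eta^2|\hat h_s|\sum_{i\in\gamma(s)\cap S(t)}|\hat h_i|)\big)e^{-\eta^2}d\eta}{\int_0^a e^{-\eta^2}d\eta}.$$ The active node plays $w_t=\sum_{\mathcal F\in\mathcal Q:\,I_t\in\mathcal F}w_t^{\mathcal F}$. **Theorem (learning a $\mathcal Q$-partition, stochastic encoding).** Each encoded gradient takes one of at most $2^k$ values, and with standard forwarding (each node forwards every message once, when it first receives it, in messages of $k$ bits, for at most $D_{\mathcal Q}$ rounds) no node sends more than $b$ bits in a round. Moreover, there is an absolute constant $C>0$ such that for every such game, every $\mathcal Q$-partition $\{\mathcal F_1,\dots,\mathcal F_r\}$ (members of $\mathcal Q$ with pairwise disjoint node sets that together contain every node that can be activated) and all $u_1,\dots,u_r\in\mathbb R^d$, with $T_j=\mathbb E\,|\{t:I_t\in\mathcal F_j\}|$ (the number of rounds in $\mathcal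 F_j$, if the activations are not random), $\mathcal R_{\mathcal F_j}(u_j)=\sum_{t:I_t\in\mathcal F_j}(\ell_t(w_t)-\ell_t(u_j))$ and $L_j=\ln(1+|\mathcal Q|D(\mathcal F_j)\|u_j\|T_jG)$, $$\mathbb E\Big[\sum_{j=1}^r\mathcal R_{\mathcal F_j}(u_j)\Big]\le C\Big(1+\sum_{j=1}^r\|u_j\|\Big(G\sqrt{\Big(1+\frac{d(3\lceil\log_2 d\rceil+2)D_{\mathcal Q}}{b}\Big)D(\mathcal F_j)T_jL_j}+\sqrt{L_j}+dG\,D(\mathcal F_j)L_j\Big)\Big).$$ If moreover $G^2T_j\ge1$ and $T_j\ge d^2D(\mathcal F_j)L_j$ for every $j$ with $u_j\ne0$, then $$\mathbb E\Big[\sum_{j=1}^r\mathcal R_{\mathcal F_j}(u_j)\Big]\le C\Big(1+\sum_{j=1}^r\|u_j\|G\sqrt{\Big(1+\frac{d(3\lceil\log_2 d\rceil+2)D_{\mathcal Q}}{b}\Big)D(\mathcal F_j)T_jL_j}\Big).$$ -/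

import Mathlib

namespace DOCO

/-- The space of predictions and gradients, with the Euclidean norm. -/
abbrev Vec (d : ℕ) := EuclideanSpace ℝ (Fin d)

section Encoding

/-- The precision `p = ⌈log₂ d⌉` of the quantization. -/
def precision (d : ℕ) : ℕ := Nat.clog 2 d

/-- The number of bits `3 ⌈log₂ d⌉ + 2` that is reserved for one repetition. -/
def symbolBits (d : ℕ) : ℕ := 3 * Nat.clog 2 d + 2

/-- What one repetition transmits: the sampled coordinate, the sign of the entry
(`true` means negative), its truncation to `p` binary digits, and the Bernoulli bit. -/
abbrev CodeSymbol (d : ℕ) := Fin d × Bool × Fin (2 ^ precision d) × Bool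

/-- A compressed gradient: `m` independent repetitions. -/
abbrev Codeword (d m : ℕ) := Fin m → CodeSymbol d

/-- The first `p` binary digits of `|y| / G`, as an integer. It is `⌊2 ^ p |y| / G⌋`, except
that `|y| = G` is read as `0.111…`, so that `p` digits suffice on all of `[-G, G]`. -/
noncomputable def level (d : ℕ) (G y : ℝ) : ℕ :=
  min ⌊2 ^ precision d * |y| / G⌋₊ (2 ^ precision d - 1)

/-- The probability that the Bernoulli bit is one: the remainder of the truncation. -/
noncomputable def bitProb (d : ℕ) (G y : ℝ) : ℝ :=
  2 ^ precision d * |y| / G - level d G y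

/-- The probability that one repetition on input `x` produces the symbol `c`: the coordinate is
uniform, and the sign and the level are determined by the entry of `x` at that coordinate. -/
noncomputable def symbolProb {d : ℕ} (G : ℝ) (x : Vec d) (c : CodeSymbol d) : ℝ :=
  if (c.2.1 = true ↔ x c.1 < 0) ∧ (c.2.2.1 : ℕ) = level d G (x c.1) then
    (1 / (d : ℝ)) *
      (if c.2.2.2 = true then bitProb d G (x c.1) else 1 - bitProb d G (x c.1))
  else 0

/-- The law of the codeword of `x`: the repetitions are independent. -/
noncomputable def encodeProb {d m : ℕ} (G : ℝ) (x : Vec d) (c : Codeword d m) : ℝ :=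
  ∏ i, symbolProb G x (c i)

/-- The quantized entry that a symbol stands for. -/
noncomputable def symbolValue {d : ℕ} (G : ℝ) (c : CodeSymbol d) : ℝ :=
  (if c.2.1 = true then -1 else 1) * (G / 2 ^ precision d) *
    ((c.2.2.1 : ℕ) + (if c.2.2.2 = true then 1 else 0))

/-- The decoder: the average over the repetitions of `d` times the quantized entry in the sampled
direction. -/
noncomputable def decode {d m : ℕ} (G : ℝ) (c : Codeword d m) : Vec d :=
  (1 / (m : ℝ)) • ∑ i, EuclideanSpace.single (c i).1 ((d : ℝ) * symbolValue G (c i))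

end Encoding

section Communication

variable {V : Type*} {𝒢 : SimpleGraph V} {T : ℕ}

/-- The diameter of a (connected) subgraph, measured inside the subgraph; a single node counts
with diameter one. -/
noncomputable def diameter (F : 𝒢.Subgraph) : ℕ := max 1 F.coe.diam

/-- The largest diameter in the collection `Q`. -/
noncomputable def maxDiameter (Q : Finset 𝒢.Subgraph) : ℕ := Q.sup diameter

/-- The number of bits per gradient. -/
noncomputable def bitsPerGradient (Q : Finset 𝒢.Subgraph) (b : ℕ) : ℕ := b / maxDiameter Q

/-- The number of repetitions in the encoding of a gradient. -/
noncomputable def repetitions (Q : Finset 𝒢.Subgraph) (b d : ℕ) : ℕ :=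
  bitsPerGradient Q b / symbolBits d

open Classical in
/-- The gradients that node `n` sends to its neighbours at the end of round `t` under the standard
forwarding strategy, if `I` is the sequence of active nodes: those that it has received for the
first time just before round `t` (or, if it is active, its own gradient of round `t`), unless
they are too old to be still of use after this transmission. -/
noncomputable def forwarded (Q : Finset 𝒢.Subgraph) (I : Fin T → V) (n : V) (t : Fin T) :
    Finset (Fin T) :=
  {s : Fin T | 𝒢.Reachable (I s) n ∧ (s : ℕ) + 𝒢.dist (I s) n = t ∧
    (t : ℕ) - s < maxDiameter Q}

open Classical in
/-- The set `S_n(t)` of the copy of the algorithm on `F`: the rounds whose gradients come from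
nodes of `F` and have reached the node `n` of `F` through `F` before round `t`. A message advances
one edge per round and is discarded when it is older than `DQ` rounds. -/
noncomputable def received (F : 𝒢.Subgraph) (DQ : ℕ) (I : Fin T → V) (n : V) (t : Fin T) :
    Finset (Fin T) :=
  {s : Fin T | s < t ∧ ∃ (hs : I s ∈ F.verts) (hn : n ∈ F.verts),
    F.coe.dist ⟨I s, hs⟩ ⟨n, hn⟩ ≤ DQ ∧ (s : ℕ) + F.coe.dist ⟨I s, hs⟩ ⟨n, hn⟩ ≤ t}

/-- The gradients that are available to the active node in round `t`. -/
noncomputable def available (F : 𝒢.Subgraph) (DQ : ℕ) (I : Fin T → V) (t : Fin T) :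
    Finset (Fin T) :=
  received F DQ I (I t) t

open Classical in
/-- The set `γ(t)` of past rounds in `F` whose gradients are missing in round `t`. -/
noncomputable def missing (F : 𝒢.Subgraph) (DQ : ℕ) (I : Fin T → V) (t : Fin T) :
    Finset (Fin T) :=
  {s : Fin T | s < t ∧ I s ∈ F.verts ∧ s ∉ available F DQ I t}

end Communication

section Algorithm

variable {V : Type*} {𝒢 : SimpleGraph V} {T d : ℕ}

/-- The part of the lag that the active node of round `t` can compute from what is available to it,
where `a s` is the magnitude of the feedback of round `s`:
`∑_{s ∈ S(t)} (a_s² + 2 a_s ∑_{i ∈ γ(s) ∩ S(t)} a_i)`. -/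
noncomputable def observedLag (F : 𝒢.Subgraph) (DQ : ℕ) (I : Fin T → V) (a : Fin T → ℝ)
    (t : Fin T) : ℝ :=
  ∑ s ∈ available F DQ I t,
    (a s ^ 2 + 2 * a s * ∑ i ∈ missing F DQ I s ∩ available F DQ I t, a i)

/-- The learning rate of AdaDelay-Dist for gradients `g` of norm at most `B` and delays at most the
diameter of `F`: the inverse root of the observed lag, plus a term of the order of what the
unobserved rounds can contribute. -/
noncomputable def learningRate (F : 𝒢.Subgraph) (DQ : ℕ) (B : ℝ) (I : Fin T → V)
    (g : Fin T → Vec d) (t : Fin T) : ℝ :=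
  1 / √(observedLag F DQ I (fun s => ‖g s‖) t + B ^ 2 * (2 * (diameter F : ℝ) + 1) ^ 2)

/-- The direction `z_t`, by AdaDelay-Dist: delayed dual averaging on the unit ball. This is the
minimizer over the unit ball of `⟪∑_{s ∈ S(t)} g_s, z⟫ + ‖z‖² / (2 η_t)`, that is, the projection of
`-η_t ∑_{s ∈ S(t)} g_s` onto the unit ball. -/
noncomputable def direction (F : 𝒢.Subgraph) (DQ : ℕ) (B : ℝ) (I : Fin T → V)
    (g : Fin T → Vec d) (t : Fin T) : Vec d :=
  let y : Vec d := -(learningRate F DQ B I g t • ∑ s ∈ available F DQ I t, g s)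
  (1 / max 1 ‖y‖) • y

/-- The one-dimensional feedback `h_t = ⟪z_t, g_t⟫`. -/
noncomputable def feedback (F : 𝒢.Subgraph) (DQ : ℕ) (B : ℝ) (I : Fin T → V)
    (g : Fin T → Vec d) (t : Fin T) : ℝ :=
  inner ℝ (direction F DQ B I g t) (g t)

/-- The upper end of the range of the prior of the scale algorithm. -/
noncomputable def priorEnd (F : 𝒢.Subgraph) (B : ℝ) : ℝ :=
  1 / (B * 20 * (1 + 2 * (diameter F : ℝ)))

/-- The scale `v_t`, by the one-dimensional comparator-adaptive algorithm with parameter `ν`, error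
parameter zero and the upper bound `B` on the gradients: the mean, with respect to the prior
density proportional to `exp (-η²)` on `[0, priorEnd]`, of
`ν η exp (-∑_{s ∈ S(t)} (η h_s + η² h_s² + 2 η² |h_s| ∑_{i ∈ γ(s) ∩ S(t)} |h_i|))`. -/
noncomputable def scale (F : 𝒢.Subgraph) (DQ : ℕ) (B ν : ℝ) (I : Fin T → V)
    (g : Fin T → Vec d) (t : Fin T) : ℝ :=
  (∫ η in (0 : ℝ)..priorEnd F B,
      ν * Real.exp (-(η * ∑ s ∈ available F DQ I t, feedback F DQ B I g s
        + η ^ 2 * observedLag F DQ I (fun s => |feedback F DQ B I g s|) t))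
        * η * Real.exp (-η ^ 2))
    / ∫ η in (0 : ℝ)..priorEnd F B, Real.exp (-η ^ 2)

/-- The prediction of the copy of the algorithm on `F`: scale times direction. -/
noncomputable def subPrediction (F : 𝒢.Subgraph) (DQ : ℕ) (B ν : ℝ) (I : Fin T → V)
    (g : Fin T → Vec d) (t : Fin T) : Vec d :=
  scale F DQ B ν I g t • direction F DQ B I g t

open Classical in
/-- Iterate addition: in round `t` the active node plays the sum of its predictions in all copies
of the algorithm to which it belongs, with `ν = 1 / |Q|` and the upper bound `2 d G` on the norms of
the approximate gradients `g`. -/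
noncomputable def prediction (Q : Finset 𝒢.Subgraph) (G : ℝ) (I : Fin T → V)
    (g : Fin T → Vec d) (t : Fin T) : Vec d :=
  ∑ F ∈ Q, if I t ∈ F.verts then
    subPrediction F (maxDiameter Q) (2 * (d : ℝ) * G) (1 / (Q.card : ℝ)) I g t else 0

end Algorithm

section Game

/-- A (non-oblivious) adversary: the active node, the loss and the revealed subgradient of
each round, as functions of the sequence of codewords. -/
structure Adversary (V : Type*) (d m T : ℕ) where
  agent : (Fin T → Codeword d m) → Fin T → V
  loss : (Fin T → Codeword d m) → Fin T → Vec d → ℝ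
  grad : (Fin T → Codeword d m) → Fin T → Vec d

variable {V : Type*} {𝒢 : SimpleGraph V} {T d m : ℕ}

/-- The prediction `w_t` if the codewords are `h`. -/
noncomputable def Adversary.play (A : Adversary V d m T) (Q : Finset 𝒢.Subgraph) (G : ℝ)
    (h : Fin T → Codeword d m) (t : Fin T) : Vec d :=
  prediction Q G (A.agent h) (fun s => decode G (h s)) t

/-- The rules of the game. -/
structure Adversary.Valid (A : Adversary V d m T) (Q : Finset 𝒢.Subgraph) (G : ℝ) : Prop where
  /-- The choices in round `t` depend only on the codewords of earlier rounds. -/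
  adapted : ∀ (h h' : Fin T → Codeword d m) (t : Fin T), (∀ s < t, h s = h' s) →
    A.agent h t = A.agent h' t ∧ A.loss h t = A.loss h' t ∧ A.grad h t = A.grad h' t
  convex : ∀ h t, ConvexOn ℝ Set.univ (A.loss h t)
  /-- The revealed vector is a subgradient of the loss at the prediction. -/
  subgradient : ∀ h t x,
    A.loss h t (A.play Q G h t) + inner ℝ (A.grad h t) (x - A.play Q G h t) ≤ A.loss h t x
  bounded : ∀ h t, ‖A.grad h t‖ ≤ G

/-- The expectation of a function of the codewords: given the past, the codeword of round `t` is
distributed as the encoding of the gradient of round `t`. -/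
noncomputable def Adversary.expect (A : Adversary V d m T) (G : ℝ)
    (f : (Fin T → Codeword d m) → ℝ) : ℝ :=
  ∑ h, (∏ t, encodeProb G (A.grad h t) (h t)) * f h

open Classical in
/-- The regret with respect to `u` over the rounds in which the active node belongs to `F`. -/
noncomputable def Adversary.cellRegret (A : Adversary V d m T) (Q : Finset 𝒢.Subgraph) (G : ℝ)
    (F : 𝒢.Subgraph) (u : Vec d) (h : Fin T → Codeword d m) : ℝ :=
  ∑ t with A.agent h t ∈ F.verts, (A.loss h t (A.play Q G h t) - A.loss h t u)

open Classical in
/-- The number of rounds in which the active node belongs to `F`. -/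
noncomputable def Adversary.cellRounds (A : Adversary V d m T) (F : 𝒢.Subgraph)
    (h : Fin T → Codeword d m) : ℝ :=
  (Finset.card {t : Fin T | A.agent h t ∈ F.verts} : ℝ)

/-- A `Q`-partition of the active nodes: a family of members of `Q` with disjoint sets of nodes
that contains every node that is ever activated. -/
structure Adversary.IsPartition (A : Adversary V d m T) (Q : Finset 𝒢.Subgraph) {r : ℕ}
    (F : Fin r → 𝒢.Subgraph) : Prop where
  mem : ∀ j, F j ∈ Q
  disjoint : ∀ i j, i ≠ j → Disjoint (F i).verts (F j).verts
  cover : ∀ h t, ∃ j, A.agent h t ∈ (F j).verts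

end Game

section Bound

variable {V : Type*} {𝒢 : SimpleGraph V}

/-- The logarithmic factor `ln (1 + |Q| D(F) ‖u‖ τ G)`. -/
noncomputable def logFactor (Q : Finset 𝒢.Subgraph) (F : 𝒢.Subgraph) (G normU τ : ℝ) : ℝ :=
  Real.log (1 + (Q.card : ℝ) * diameter F * normU * τ * G)

/-- The leading term
`‖u‖ G √((1 + d (3 ⌈log₂ d⌉ + 2) D_Q / b) D(F) τ ln (1 + |Q| D(F) ‖u‖ τ G))`. -/
noncomputable def leadingTerm (Q : Finset 𝒢.Subgraph) (b d : ℕ) (F : 𝒢.Subgraph)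
    (G normU τ : ℝ) : ℝ :=
  normU * G * √((1 + (d : ℝ) * symbolBits d * maxDiameter Q / b) * diameter F * τ
    * logFactor Q F G normU τ)

/-- The terms of lower order
`‖u‖ (√(ln (1 + |Q| D(F) ‖u‖ τ G)) + d G D(F) ln (1 + |Q| D(F) ‖u‖ τ G))`. -/
noncomputable def lowerOrderTerm (Q : Finset 𝒢.Subgraph) (d : ℕ) (F : 𝒢.Subgraph)
    (G normU τ : ℝ) : ℝ :=
  normU * (√(logFactor Q F G normU τ) + d * G * diameter F * logFactor Q F G normU τ)

end Bound

end DOCO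

/-!
The losses are linearized at the predictions by the subgradient inequality, and the subgradients are
replaced by the decoded vectors. The latter does not change expectations, because a decoded
vector is an unbiased estimate given the past, whereas predictions and memberships are determined by
the past (`Adversary.Valid.expect_inner_decode`, and the causality lemmas such as
`subPrediction_congr`). Since the prediction is the sum of the predictions of all copies, the regret
over a partition is at most the sum of the linearized regrets of the copies, where the copies
outside the partition compete with zero (`Adversary.Valid.expect_sum_cellRegret_le`). A copy with
comparator zero costs at most `ν = 1 / |Q|`, so all these constants add up to one.

A copy with comparator `u ≠ 0` decomposes into the regret of the scale against `‖u‖` and `‖u‖` times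
the regret of the direction against `u / ‖u‖`. Both are bounded along every sequence of codewords,
in terms of the lag `Λ = ∑ (a_t² + 2 a_t ∑_{i ∈ γ t} a_i)` with `a_t = ‖g_t‖`; a message is missing for
fewer rounds than the diameter `D` of the subgraph, so that the lag that an agent can compute falls
short of the true one by at most `O(B D)` times the missing norms
(`DelayPattern.sumBefore_lag_sub_availableLag_le`).

* Direction: compared with dual averaging on complete feedback, with the learning rate
  `ρ = (Λ + c)^(-1/2)`, `c = B² (2 D + 1)²`, the direction moves by at most `3 ρ` times the missing
  norms. The resulting sum of lags weighted by `ρ` telescopes to `O(√(Λ + c))`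
  (`DelayPattern.sum_inner_delayedDirection_sub_le`).
* Scale: for each learning rate `η` in the support of the prior, the potential
  `exp (-(η ∑ h + η² Λ))` drops in each round by at least `η h_t φ_t(η)`, where `φ_t` is the
  potential that the agent can compute (`DelayPattern.potential_step`). Averaging over the prior gives regret
  at most `ν` against zero, and a lower bound for the mean of the final potential gives the regret
  against `U = ‖u‖`, with a learning rate `η₀` that is free in the analysis
  (`DelayPattern.sum_mul_meanScale_sub_le`).

Since `η₀` is free, it can be chosen from the expected number of rounds, so that the bound is affine
in the random lag, up to a square root handled by Jensen's inequality. As a round misses, and is missed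
by, at most `D` rounds, the expected lag is `O(D)` times the sum of the second moments of the
decoded vectors, which are `O(G² (1 + d / m))` (`sum_encodeProb_mul_norm_decode_sq_le`). The choice of `η₀`
is made in `regret_le_of_balanced_rate`. In the remaining regimes (small logarithm, few rounds, or
`G τ ≤ 1`) the bound `1 / |Q| + ‖u‖ G τ` suffices.
-/

namespace DOCO

/-! ### Delayed feedback: the lag and its observed part -/

section Delay

variable {T : ℕ}

/-- The pattern of feedback in the rounds `R`: in round `t` the feedback of the rounds `S t` is
available, that of the remaining past rounds `γ t` is missing, and no feedback is missing for
`D` rounds or more. -/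
structure DelayPattern (R : Finset (Fin T)) (S γ : Fin T → Finset (Fin T)) (D : ℕ) : Prop where
  mem_missing : ∀ t ∈ R, ∀ s, s ∈ γ t ↔ s ∈ R ∧ s < t ∧ s ∉ S t
  mem_available : ∀ t ∈ R, ∀ s ∈ S t, s ∈ R ∧ s < t
  recent : ∀ t ∈ R, ∀ s ∈ γ t, (t : ℕ) < s + D

/-- The contribution `a_t² + 2 a_t ∑_{i ∈ γ t} a_i` of round `t` to the lag. -/
def lag (γ : Fin T → Finset (Fin T)) (a : Fin T → ℝ) (t : Fin T) : ℝ :=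
  a t ^ 2 + 2 * a t * ∑ i ∈ γ t, a i

/-- The sum of `f` over the rounds of `R` before round `k`. -/
def sumBefore {M : Type*} [AddCommMonoid M] (R : Finset (Fin T)) (f : Fin T → M) (k : ℕ) : M :=
  ∑ s ∈ R.filter (fun s : Fin T => (s : ℕ) < k), f s

/-- The part of the lag that is computable from the feedback available in round `t`. -/
def availableLag (S γ : Fin T → Finset (Fin T)) (a : Fin T → ℝ) (t : Fin T) : ℝ :=
  ∑ s ∈ S t, (a s ^ 2 + 2 * a s * ∑ i ∈ γ s ∩ S t, a i)

lemma sumBefore_zero {M : Type*} [AddCommMonoid M] (R : Finset (Fin T)) (f : Fin T → M) :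
    sumBefore R f 0 = 0 := by simp [sumBefore]

lemma sumBefore_last {M : Type*} [AddCommMonoid M] (R : Finset (Fin T)) (f : Fin T → M) :
    sumBefore R f T = ∑ t ∈ R, f t := by simp [sumBefore]

lemma sumBefore_succ_of_mem {M : Type*} [AddCommMonoid M] {R : Finset (Fin T)} (f : Fin T → M)
    {t : Fin T} (ht : t ∈ R) : sumBefore R f (t + 1) = sumBefore R f t + f t := by
  have : R.filter (fun s : Fin T => (s : ℕ) < t + 1)
      = insert t (R.filter (fun s : Fin T => (s : ℕ) < t)) := by
    ext s
    simp only [Finset.mem_filter, Finset.mem_insert, Fin.ext_iff]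
    constructor
    · rintro ⟨h1, h2⟩
      by_cases h : (s : ℕ) = t
      · exact Or.inl h
      · exact Or.inr ⟨h1, by omega⟩
    · rintro (h | ⟨h1, h2⟩)
      · have : s = t := Fin.ext h
        subst this
        exact ⟨ht, by omega⟩
      · exact ⟨h1, by omega⟩
  rw [sumBefore, this, Finset.sum_insert (by simp), add_comm]
  rfl

lemma sumBefore_succ_of_notMem {M : Type*} [AddCommMonoid M] {R : Finset (Fin T)} (f : Fin T → M)
    {t : Fin T} (ht : t ∉ R) : sumBefore R f (t + 1) = sumBefore R f t := by
  unfold sumBefore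
  congr 1
  ext s
  simp only [Finset.mem_filter]
  constructor
  · rintro ⟨h1, h2⟩
    refine ⟨h1, ?_⟩
    have : (s : ℕ) ≠ t := fun h => ht (Fin.ext h ▸ h1)
    omega
  · rintro ⟨h1, h2⟩
    exact ⟨h1, by omega⟩

lemma sumBefore_mono_of_nonneg {R : Finset (Fin T)} {f : Fin T → ℝ} (hf : ∀ t ∈ R, 0 ≤ f t)
    {k l : ℕ} (h : k ≤ l) : sumBefore R f k ≤ sumBefore R f l := by
  refine Finset.sum_le_sum_of_subset_of_nonneg ?_ ?_
  · intro s hs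
    simp only [Finset.mem_filter] at hs ⊢
    exact ⟨hs.1, by omega⟩
  · intro s hs _
    exact hf s (Finset.mem_filter.1 hs).1

lemma sumBefore_nonneg {R : Finset (Fin T)} {f : Fin T → ℝ} (hf : ∀ t ∈ R, 0 ≤ f t) (k : ℕ) :
    0 ≤ sumBefore R f k :=
  Finset.sum_nonneg fun s hs => hf s (Finset.mem_filter.1 hs).1

/-- Telescoping along the rounds of `R`. -/
lemma sum_le_sub_of_step {R : Finset (Fin T)} {f : Fin T → ℝ} {P : ℕ → ℝ}
    (h : ∀ t ∈ R, f t ≤ P (t + 1) - P t) (h' : ∀ t : Fin T, t ∉ R → P (t + 1) = P t) :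
    ∑ t ∈ R, f t ≤ P T - P 0 := by
  have h1 : ∑ t ∈ R, f t = ∑ t : Fin T, if t ∈ R then f t else 0 := by
    rw [← Finset.sum_filter]; simp
  rw [h1, ← Finset.sum_range_sub, ← Fin.sum_univ_eq_sum_range (fun i => P (i + 1) - P i)]
  refine Finset.sum_le_sum fun t _ => ?_
  split_ifs with ht
  · exact h t ht
  · rw [h' t ht, sub_self]

variable {R : Finset (Fin T)} {S γ : Fin T → Finset (Fin T)} {D : ℕ} {a : Fin T → ℝ} {B : ℝ}

namespace DelayPattern

lemma sumBefore_eq {M : Type*} [AddCommMonoid M] (hP : DelayPattern R S γ D) (f : Fin T → M)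
    {t : Fin T} (ht : t ∈ R) : sumBefore R f t = ∑ s ∈ S t, f s + ∑ s ∈ γ t, f s := by
  rw [sumBefore, ← Finset.sum_union]
  · congr 1
    ext s
    simp only [Finset.mem_filter, Finset.mem_union, hP.mem_missing t ht, Fin.val_fin_lt]
    have := hP.mem_available t ht s
    tauto
  · rw [Finset.disjoint_left]
    intro s hs hs'
    exact ((hP.mem_missing t ht s).1 hs').2.2 hs

lemma card_missing_le (hP : DelayPattern R S γ D) {t : Fin T} (ht : t ∈ R) :
    (γ t).card ≤ D := by
  have : (γ t).card ≤ (Finset.Ico ((t : ℕ) - D) t).card := by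
    refine Finset.card_le_card_of_injOn (fun s => (s : ℕ)) ?_ (fun x _ y _ h => Fin.ext h)
    intro s hs
    have h1 := hP.recent t ht s hs
    have h2 : s < t := ((hP.mem_missing t ht s).1 hs).2.1
    simp only [Finset.coe_Ico, Set.mem_Ico]
    exact ⟨by omega, h2⟩
  refine this.trans ?_
  simp only [Nat.card_Ico]
  omega

lemma card_missed_le (hP : DelayPattern R S γ D) (i : Fin T) :
    (R.filter (fun s => i ∈ γ s)).card ≤ D := by
  have : (R.filter (fun s => i ∈ γ s)).card ≤ (Finset.Ico (i : ℕ) (i + D)).card := by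
    refine Finset.card_le_card_of_injOn (fun s => (s : ℕ)) ?_ (fun x _ y _ h => Fin.ext h)
    intro s hs
    have hs := Finset.mem_filter.1 hs
    have h1 := hP.recent s hs.1 i hs.2
    have h2 : i < s := ((hP.mem_missing s hs.1 i).1 hs.2).2.1
    simp only [Finset.coe_Ico, Set.mem_Ico]
    exact ⟨le_of_lt h2, h1⟩
  simpa using this

lemma sum_missing_le (hP : DelayPattern R S γ D) (haB : ∀ t ∈ R, a t ≤ B)
    (hB : 0 ≤ B) {t : Fin T} (ht : t ∈ R) : ∑ i ∈ γ t, a i ≤ D * B := by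
  calc ∑ i ∈ γ t, a i ≤ ∑ i ∈ γ t, B :=
        Finset.sum_le_sum fun i hi => haB i ((hP.mem_missing t ht i).1 hi).1
    _ = (γ t).card * B := by simp
    _ ≤ D * B := by
        gcongr
        exact hP.card_missing_le ht

lemma sum_missing_nonneg (hP : DelayPattern R S γ D) (ha : ∀ t ∈ R, 0 ≤ a t) {t : Fin T}
    (ht : t ∈ R) : 0 ≤ ∑ i ∈ γ t, a i :=
  Finset.sum_nonneg fun i hi => ha i ((hP.mem_missing t ht i).1 hi).1

lemma lag_nonneg (hP : DelayPattern R S γ D) (ha : ∀ t ∈ R, 0 ≤ a t) {t : Fin T}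
    (ht : t ∈ R) : 0 ≤ lag γ a t := by
  have h1 := hP.sum_missing_nonneg ha ht
  have h2 := ha t ht
  unfold lag
  positivity

lemma lag_le (hP : DelayPattern R S γ D) (ha : ∀ t ∈ R, 0 ≤ a t) (haB : ∀ t ∈ R, a t ≤ B)
    (hB : 0 ≤ B) {t : Fin T} (ht : t ∈ R) : lag γ a t ≤ a t * (B * (1 + 2 * D)) := by
  have h1 := hP.sum_missing_le haB hB ht
  have h2 := ha t ht
  have h3 := haB t ht
  unfold lag
  nlinarith [mul_le_mul_of_nonneg_left h1 h2, mul_le_mul_of_nonneg_left h3 h2]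

/-- A round is missing in at most `D` later rounds. -/
lemma sum_sum_missing_le (hP : DelayPattern R S γ D) {A : Finset (Fin T)} (hA : A ⊆ R)
    (K : Finset (Fin T)) (haK : ∀ i ∈ K, 0 ≤ a i) :
    ∑ s ∈ A, ∑ i ∈ γ s ∩ K, a i ≤ D * ∑ i ∈ K, a i := by
  calc ∑ s ∈ A, ∑ i ∈ γ s ∩ K, a i = ∑ s ∈ A, ∑ i ∈ K, if i ∈ γ s then a i else 0 := by
        refine Finset.sum_congr rfl fun s _ => ?_
        rw [← Finset.sum_filter]
        congr 1
        ext i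
        simp [and_comm]
    _ = ∑ i ∈ K, ∑ s ∈ A, if i ∈ γ s then a i else 0 := Finset.sum_comm
    _ = ∑ i ∈ K, ((A.filter (fun s => i ∈ γ s)).card : ℝ) * a i := by
        refine Finset.sum_congr rfl fun i _ => ?_
        rw [← Finset.sum_filter]; simp
    _ ≤ ∑ i ∈ K, (D : ℝ) * a i := by
        refine Finset.sum_le_sum fun i hi => mul_le_mul_of_nonneg_right ?_ (haK i hi)
        have h1 : (A.filter (fun s => i ∈ γ s)).card ≤ D :=
          (Finset.card_le_card (Finset.filter_subset_filter _ hA)).trans (hP.card_missed_le i)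
        exact_mod_cast h1
    _ = D * ∑ i ∈ K, a i := by rw [Finset.mul_sum]

/-- The unobserved part of the lag consists of the lags of the missing rounds and of the pairs of
an available and a missing round. -/
lemma sumBefore_lag_sub_availableLag (hP : DelayPattern R S γ D) {t : Fin T} (ht : t ∈ R) :
    sumBefore R (lag γ a) t - availableLag S γ a t =
      ∑ i ∈ γ t, lag γ a i + ∑ s ∈ S t, 2 * a s * ∑ i ∈ γ s ∩ γ t, a i := by
  rw [hP.sumBefore_eq _ ht, availableLag]
  have key : ∀ s ∈ S t, lag γ a s = (a s ^ 2 + 2 * a s * ∑ i ∈ γ s ∩ S t, a i)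
      + 2 * a s * ∑ i ∈ γ s ∩ γ t, a i := by
    intro s hs
    obtain ⟨hsR, hst⟩ := hP.mem_available t ht s hs
    have : γ s ∩ γ t = γ s \ S t := by
      ext i
      simp only [Finset.mem_inter, Finset.mem_sdiff, hP.mem_missing t ht]
      constructor
      · rintro ⟨h1, h2⟩
        exact ⟨h1, h2.2.2⟩
      · rintro ⟨h1, h2⟩
        have h3 := (hP.mem_missing s hsR i).1 h1
        exact ⟨h1, h3.1, h3.2.1.trans hst, h2⟩
    rw [this, lag, ← Finset.sum_inter_add_sum_sdiff (γ s) (S t)]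
    ring
  rw [Finset.sum_congr rfl key, Finset.sum_add_distrib]
  ring

lemma availableLag_le (hP : DelayPattern R S γ D) (ha : ∀ t ∈ R, 0 ≤ a t) {t : Fin T}
    (ht : t ∈ R) : availableLag S γ a t ≤ sumBefore R (lag γ a) t := by
  have h := hP.sumBefore_lag_sub_availableLag (a := a) ht
  have h1 : 0 ≤ ∑ i ∈ γ t, lag γ a i :=
    Finset.sum_nonneg fun i hi => hP.lag_nonneg ha ((hP.mem_missing t ht i).1 hi).1
  have h2 : 0 ≤ ∑ s ∈ S t, 2 * a s * ∑ i ∈ γ s ∩ γ t, a i := by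
    refine Finset.sum_nonneg fun s hs => ?_
    have := ha s (hP.mem_available t ht s hs).1
    have h3 : 0 ≤ ∑ i ∈ γ s ∩ γ t, a i := Finset.sum_nonneg fun i hi =>
      ha i ((hP.mem_missing t ht i).1 (Finset.mem_inter.1 hi).2).1
    positivity
  linarith

lemma availableLag_nonneg (hP : DelayPattern R S γ D) (ha : ∀ t ∈ R, 0 ≤ a t) {t : Fin T}
    (ht : t ∈ R) : 0 ≤ availableLag S γ a t := by
  refine Finset.sum_nonneg fun s hs => ?_
  have := ha s (hP.mem_available t ht s hs).1
  have h3 : 0 ≤ ∑ i ∈ γ s ∩ S t, a i := Finset.sum_nonneg fun i hi =>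
      ha i (hP.mem_available t ht i (Finset.mem_inter.1 hi).2).1
  positivity

lemma sumBefore_lag_sub_availableLag_le (hP : DelayPattern R S γ D) (ha : ∀ t ∈ R, 0 ≤ a t)
    (haB : ∀ t ∈ R, a t ≤ B) (hB : 0 ≤ B) {t : Fin T} (ht : t ∈ R) :
    sumBefore R (lag γ a) t - availableLag S γ a t ≤ B * (1 + 4 * D) * ∑ i ∈ γ t, a i := by
  rw [hP.sumBefore_lag_sub_availableLag ht]
  have hγ : ∀ i ∈ γ t, i ∈ R := fun i hi => ((hP.mem_missing t ht i).1 hi).1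
  have hS : ∀ s ∈ S t, s ∈ R := fun s hs => (hP.mem_available t ht s hs).1
  have h1 : ∑ i ∈ γ t, lag γ a i ≤ ∑ i ∈ γ t, a i * (B * (1 + 2 * D)) :=
    Finset.sum_le_sum fun i hi => hP.lag_le ha haB hB (hγ i hi)
  rw [← Finset.sum_mul] at h1
  have h2 : ∑ s ∈ S t, 2 * a s * ∑ i ∈ γ s ∩ γ t, a i
      ≤ ∑ s ∈ S t, 2 * B * ∑ i ∈ γ s ∩ γ t, a i := by
    refine Finset.sum_le_sum fun s hs => ?_
    have h3 : 0 ≤ ∑ i ∈ γ s ∩ γ t, a i := Finset.sum_nonneg fun i hi =>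
      ha i (hγ i (Finset.mem_inter.1 hi).2)
    have := haB s (hS s hs)
    gcongr
  rw [← Finset.mul_sum] at h2
  have h3 := hP.sum_sum_missing_le (A := S t) hS (γ t) (fun i hi => ha i (hγ i hi))
  nlinarith [mul_le_mul_of_nonneg_left h3 hB]

/-- Since a round misses at most `D` rounds and is missed by at most `D` rounds, the lag is at most
`1 + 2 D` times the sum of squares. -/
lemma sum_lag_le (hP : DelayPattern R S γ D) :
    ∑ t ∈ R, lag γ a t ≤ (1 + 2 * D) * ∑ t ∈ R, a t ^ 2 := by
  have h1 : ∀ t ∈ R, lag γ a t ≤ a t ^ 2 + D * a t ^ 2 + ∑ i ∈ γ t ∩ R, a i ^ 2 := by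
    intro t ht
    have e : γ t ∩ R = γ t := Finset.inter_eq_left.2 fun i hi =>
      ((hP.mem_missing t ht i).1 hi).1
    have h2 : 2 * a t * ∑ i ∈ γ t, a i ≤ ∑ i ∈ γ t, (a t ^ 2 + a i ^ 2) := by
      rw [Finset.mul_sum]
      exact Finset.sum_le_sum fun i _ => two_mul_le_add_sq _ _
    rw [Finset.sum_add_distrib, Finset.sum_const, nsmul_eq_mul] at h2
    have h3 : ((γ t).card : ℝ) * a t ^ 2 ≤ D * a t ^ 2 := by
      gcongr
      exact hP.card_missing_le ht
    rw [e, lag]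
    linarith
  have h2 := hP.sum_sum_missing_le (a := fun i => a i ^ 2) (Finset.Subset.refl R) R
    (fun i _ => sq_nonneg _)
  have h3 := Finset.sum_le_sum h1
  rw [Finset.sum_add_distrib, Finset.sum_add_distrib, ← Finset.mul_sum] at h3
  linarith

end DelayPattern

end Delay

/-! ### The scale: a comparator-adaptive algorithm on the line under delays -/

section Scale

open MeasureTheory intervalIntegral

variable {T : ℕ} {R : Finset (Fin T)} {S γ : Fin T → Finset (Fin T)} {D : ℕ} {B : ℝ}

/-- A quadratic bound on the exponential whose leading coefficient is close enough to `1 / 2` to be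
absorbed by the term `η² h²` of the lag. -/
lemma exp_neg_le_quadratic {y : ℝ} (hy : |y| ≤ 1 / 10) :
    Real.exp (-y) ≤ 1 - y + 53 / 100 * y ^ 2 := by
  have h := Real.exp_bound (x := -y) (by rw [abs_neg]; linarith) (n := 3) (by norm_num)
  have h2 := (abs_le.1 h).2
  simp only [Finset.sum_range_succ, Finset.sum_range_zero, Nat.factorial, abs_neg] at h2
  norm_num at h2
  have h3 : |y| ^ 3 ≤ 1 / 10 * y ^ 2 := by
    rw [pow_succ, sq_abs]; nlinarith [sq_nonneg y]
  nlinarith [sq_nonneg y]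

/-- One step of the potential argument: `x` is the scaled feedback, `w` bounds the scaled missing
feedback, and `δ` is the logarithm of the ratio of the computable to the ideal potential. -/
lemma mul_exp_le_one_sub_exp {x w δ : ℝ} (hx : |x| ≤ 1 / 20) (hw0 : 0 ≤ w) (hw : w ≤ 1 / 40)
    (hδ1 : -w ≤ δ) (hδ2 : δ ≤ 11 / 10 * w) :
    x * Real.exp δ ≤ 1 - Real.exp (-(x + (x ^ 2 + 2 * |x| * w))) := by
  have hx0 := abs_nonneg x
  have hsq : x ^ 2 = |x| ^ 2 := (sq_abs x).symm
  have hy : |x + (x ^ 2 + 2 * |x| * w)| ≤ 11 / 10 * |x| := by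
    refine (abs_add_le _ _).trans ?_
    rw [abs_of_nonneg (by positivity : 0 ≤ x ^ 2 + 2 * |x| * w), hsq]
    nlinarith
  have h1 := exp_neg_le_quadratic (y := x + (x ^ 2 + 2 * |x| * w)) (by linarith)
  have h2 : (x + (x ^ 2 + 2 * |x| * w)) ^ 2 ≤ (11 / 10 * |x|) ^ 2 := by
    rw [← sq_abs (x + (x ^ 2 + 2 * |x| * w))]
    gcongr
  have h3 : x + 2 * |x| * w ≤ 1 - Real.exp (-(x + (x ^ 2 + 2 * |x| * w))) := by
    nlinarith [sq_nonneg x]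
  refine le_trans ?_ h3
  have hδ : |δ| ≤ 1 := abs_le.2 ⟨by linarith, by linarith⟩
  rcases le_or_gt 0 x with h | h
  · have h4 := (abs_le.1 (Real.abs_exp_sub_one_sub_id_le hδ)).2
    have h5 : δ ^ 2 ≤ (11 / 10 * w) ^ 2 := by
      rw [← sq_abs δ]
      gcongr
      exact abs_le.2 ⟨by linarith, hδ2⟩
    have h6 : Real.exp δ ≤ 1 + 2 * w := by nlinarith
    rw [abs_of_nonneg h]
    nlinarith
  · have h4 := Real.add_one_le_exp δ
    rw [abs_of_neg h]
    nlinarith [mul_nonneg (neg_nonneg.2 h.le) hw0]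

/-- The potential `exp (-(η ∑ h + η² Λ))` of the complete feedback drops in round `t` by at least
the gain `η h_t φ_t` of the computable potential `φ_t`. -/
lemma DelayPattern.potential_step (hP : DelayPattern R S γ D) {h : Fin T → ℝ}
    (hB : 0 ≤ B) (hh : ∀ t ∈ R, |h t| ≤ B) {η : ℝ} (hη : 0 ≤ η)
    (hηB : η * (B * (1 + 2 * D)) ≤ 1 / 20) {t : Fin T} (ht : t ∈ R) :
    η * h t * Real.exp (-(η * ∑ s ∈ S t, h s + η ^ 2 * availableLag S γ (fun s => |h s|) t)) ≤
      Real.exp (-(η * sumBefore R h t + η ^ 2 * sumBefore R (lag γ fun s => |h s|) t)) -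
      Real.exp (-(η * sumBefore R h (t + 1) +
        η ^ 2 * sumBefore R (lag γ fun s => |h s|) (t + 1))) := by
  set H := ∑ i ∈ γ t, |h i| with hH
  set Λ := sumBefore R (lag γ fun s => |h s|) t with hΛ
  set O := availableLag S γ (fun s => |h s|) t with hO
  have hH0 : 0 ≤ H := Finset.sum_nonneg fun i _ => abs_nonneg _
  have hHB : H ≤ D * B := hP.sum_missing_le (a := fun s => |h s|) hh hB ht
  have hgap0 : O ≤ Λ := hP.availableLag_le (a := fun s => |h s|) (fun _ _ => abs_nonneg _) ht
  have hgap : Λ - O ≤ B * (1 + 4 * D) * H :=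
    hP.sumBefore_lag_sub_availableLag_le (a := fun s => |h s|) (fun _ _ => abs_nonneg _) hh hB ht
  have hD : (0 : ℝ) ≤ D := Nat.cast_nonneg D
  have hηB1 : 0 ≤ η * B := by positivity
  have hηBD : 0 ≤ η * B * D := by positivity
  have hx : |η * h t| ≤ 1 / 20 := by
    rw [abs_mul, abs_of_nonneg hη]
    have := mul_le_mul_of_nonneg_left (hh t ht) hη
    nlinarith
  have hw : η * H ≤ 1 / 40 := by
    have := mul_le_mul_of_nonneg_left hHB hη
    nlinarith
  have hmiss : |η * ∑ i ∈ γ t, h i| ≤ η * H := by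
    rw [abs_mul, abs_of_nonneg hη]
    exact mul_le_mul_of_nonneg_left (Finset.abs_sum_le_sum_abs _ _) hη
  have hquad : η ^ 2 * (Λ - O) ≤ 1 / 10 * (η * H) := by
    have h1 := mul_le_mul_of_nonneg_left hgap (sq_nonneg η)
    have h2 : η * (B * (1 + 4 * D)) ≤ 1 / 10 := by nlinarith
    have h3 := mul_le_mul_of_nonneg_right h2 (mul_nonneg hη hH0)
    nlinarith
  have hquad0 : 0 ≤ η ^ 2 * (Λ - O) := mul_nonneg (sq_nonneg _) (sub_nonneg.2 hgap0)
  have key := mul_exp_le_one_sub_exp (x := η * h t) (w := η * H)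
    (δ := η * ∑ i ∈ γ t, h i + η ^ 2 * (Λ - O)) hx (mul_nonneg hη hH0) hw
    (by linarith [(abs_le.1 hmiss).1]) (by linarith [(abs_le.1 hmiss).2])
  have hsum := hP.sumBefore_eq h ht
  rw [sumBefore_succ_of_mem h ht, sumBefore_succ_of_mem (lag γ fun s => |h s|) ht, ← hΛ]
  have e1 : Real.exp (-(η * ∑ s ∈ S t, h s + η ^ 2 * O)) =
      Real.exp (-(η * sumBefore R h t + η ^ 2 * Λ)) *
        Real.exp (η * ∑ i ∈ γ t, h i + η ^ 2 * (Λ - O)) := by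
    rw [← Real.exp_add, hsum]
    congr 1
    ring
  have e2 : Real.exp (-(η * (sumBefore R h t + h t) +
      η ^ 2 * (Λ + lag γ (fun s => |h s|) t))) =
      Real.exp (-(η * sumBefore R h t + η ^ 2 * Λ)) *
        Real.exp (-(η * h t + ((η * h t) ^ 2 + 2 * |η * h t| * (η * H)))) := by
    rw [← Real.exp_add, lag, abs_mul, abs_of_nonneg hη, sq_abs]
    congr 1
    ring
  rw [e1, e2]
  have := mul_le_mul_of_nonneg_left key
    (Real.exp_nonneg (-(η * sumBefore R h t + η ^ 2 * Λ)))
  linarith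

/-- The scale: the mean of `ν η φ_t(η)` with respect to the density proportional to `exp (-η²)` on
`[0, e]`, where `φ_t` is the computable potential. -/
noncomputable def meanScale (S γ : Fin T → Finset (Fin T)) (e ν : ℝ) (h : Fin T → ℝ)
    (t : Fin T) : ℝ :=
  (∫ η in (0 : ℝ)..e,
      ν * Real.exp (-(η * ∑ s ∈ S t, h s + η ^ 2 * availableLag S γ (fun s => |h s|) t))
        * η * Real.exp (-η ^ 2)) / ∫ η in (0 : ℝ)..e, Real.exp (-η ^ 2)

lemma integral_exp_neg_sq_pos {e : ℝ} (he : 0 < e) :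
    0 < ∫ η in (0 : ℝ)..e, Real.exp (-η ^ 2) :=
  intervalIntegral_pos_of_pos (Continuous.intervalIntegrable (by fun_prop) _ _)
    (fun _ => Real.exp_pos _) he

lemma integral_exp_neg_sq_le_self {e : ℝ} (he : 0 < e) :
    ∫ η in (0 : ℝ)..e, Real.exp (-η ^ 2) ≤ e := by
  calc ∫ η in (0 : ℝ)..e, Real.exp (-η ^ 2) ≤ ∫ _η in (0 : ℝ)..e, (1 : ℝ) := by
        refine integral_mono_on he.le (Continuous.intervalIntegrable (by fun_prop) _ _)
          (Continuous.intervalIntegrable (by fun_prop) _ _) fun x _ => ?_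
        exact Real.exp_le_one_iff.2 (by nlinarith [sq_nonneg x])
    _ = e := by simp

lemma integral_exp_neg_sq_le_one {e : ℝ} (he : 0 < e) :
    ∫ η in (0 : ℝ)..e, Real.exp (-η ^ 2) ≤ 1 := by
  have hint : Integrable fun x : ℝ => Real.exp (-1 * x ^ 2) :=
    integrable_exp_neg_mul_sq one_pos
  rw [integral_of_le he.le]
  calc ∫ x in Set.Ioc 0 e, Real.exp (-x ^ 2) = ∫ x in Set.Ioc 0 e, Real.exp (-1 * x ^ 2) := by
        simp
    _ ≤ ∫ x in Set.Ioi 0, Real.exp (-1 * x ^ 2) :=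
        setIntegral_mono_set hint.integrableOn
          (Filter.Eventually.of_forall fun x => Real.exp_nonneg _)
          (Filter.Eventually.of_forall Set.Ioc_subset_Ioi_self)
    _ = √(Real.pi / 1) / 2 := integral_gaussian_Ioi 1
    _ ≤ 1 := by
        have : √(Real.pi / 1) ≤ 2 := by
          rw [Real.sqrt_le_left (by norm_num)]
          linarith [Real.pi_le_four]
        linarith

/-- The cumulative loss of the scale is at most `ν`, minus `ν` times the mean of the final
potential. -/
lemma DelayPattern.sum_mul_meanScale_le (hP : DelayPattern R S γ D) {h : Fin T → ℝ}
    (hB : 0 ≤ B) (hh : ∀ t ∈ R, |h t| ≤ B) {e ν : ℝ} (he : 0 < e) (hν : 0 ≤ ν)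
    (heB : e * (B * (1 + 2 * D)) ≤ 1 / 20) :
    ∑ t ∈ R, h t * meanScale S γ e ν h t ≤
      ν - ν * (∫ η in (0 : ℝ)..e, Real.exp (-(η * ∑ t ∈ R, h t +
        η ^ 2 * ∑ t ∈ R, lag γ (fun s => |h s|) t)) * Real.exp (-η ^ 2)) /
          ∫ η in (0 : ℝ)..e, Real.exp (-η ^ 2) := by
  have hZ := integral_exp_neg_sq_pos he
  have hpt : ∀ η ∈ Set.Icc 0 e,
      ∑ t ∈ R, h t * (ν * Real.exp (-(η * ∑ s ∈ S t, h s +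
        η ^ 2 * availableLag S γ (fun s => |h s|) t)) * η * Real.exp (-η ^ 2)) ≤
      ν * Real.exp (-η ^ 2) - ν * (Real.exp (-(η * ∑ t ∈ R, h t +
        η ^ 2 * ∑ t ∈ R, lag γ (fun s => |h s|) t)) * Real.exp (-η ^ 2)) := by
    intro η hη
    have hηB : η * (B * (1 + 2 * D)) ≤ 1 / 20 :=
      (mul_le_mul_of_nonneg_right hη.2 (by positivity)).trans heB
    have h1 := sum_le_sub_of_step (R := R)
      (f := fun t => η * h t * Real.exp (-(η * ∑ s ∈ S t, h s +
        η ^ 2 * availableLag S γ (fun s => |h s|) t)))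
      (P := fun k => -Real.exp (-(η * sumBefore R h k +
        η ^ 2 * sumBefore R (lag γ fun s => |h s|) k)))
      (fun t ht => by
        have := hP.potential_step hB hh hη.1 hηB ht
        linarith)
      (fun t ht => by
        simp only [sumBefore_succ_of_notMem _ ht])
    simp only [sumBefore_last, sumBefore_zero, mul_zero, add_zero, neg_zero, Real.exp_zero] at h1
    have h2 := mul_le_mul_of_nonneg_left h1 (mul_nonneg hν (Real.exp_nonneg (-η ^ 2)))
    rw [Finset.mul_sum] at h2
    calc _ = ∑ t ∈ R, ν * Real.exp (-η ^ 2) * (η * h t * Real.exp (-(η * ∑ s ∈ S t, h s +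
        η ^ 2 * availableLag S γ (fun s => |h s|) t))) :=
          Finset.sum_congr rfl fun t _ => by ring
      _ ≤ _ := h2
      _ = _ := by ring
  have hint := integral_mono_on (μ := volume) he.le
    (Continuous.intervalIntegrable (by fun_prop) _ _)
    (Continuous.intervalIntegrable (by fun_prop) _ _) hpt
  rw [integral_finsetSum (fun t _ => Continuous.intervalIntegrable (by fun_prop) _ _),
    integral_sub (Continuous.intervalIntegrable (by fun_prop) _ _)
      (Continuous.intervalIntegrable (by fun_prop) _ _)] at hint
  simp only [intervalIntegral.integral_const_mul] at hint
  have : ∑ t ∈ R, h t * meanScale S γ e ν h t =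
      (∑ t ∈ R, h t * ∫ η in (0 : ℝ)..e,
      ν * Real.exp (-(η * ∑ s ∈ S t, h s + η ^ 2 * availableLag S γ (fun s => |h s|) t))
        * η * Real.exp (-η ^ 2)) / ∫ η in (0 : ℝ)..e, Real.exp (-η ^ 2) := by
    rw [Finset.sum_div]
    refine Finset.sum_congr rfl fun t _ => ?_
    rw [meanScale, mul_div_assoc]
  rw [this, div_le_iff₀ hZ, sub_mul, div_mul_cancel₀ _ hZ.ne']
  refine le_trans (le_of_eq ?_) hint
  refine Finset.sum_congr rfl fun t _ => ?_
  congr 2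

lemma DelayPattern.sum_mul_meanScale_le_const (hP : DelayPattern R S γ D) {h : Fin T → ℝ}
    (hB : 0 ≤ B) (hh : ∀ t ∈ R, |h t| ≤ B) {e ν : ℝ} (he : 0 < e) (hν : 0 ≤ ν)
    (heB : e * (B * (1 + 2 * D)) ≤ 1 / 20) :
    ∑ t ∈ R, h t * meanScale S γ e ν h t ≤ ν := by
  refine (hP.sum_mul_meanScale_le hB hh he hν heB).trans (sub_le_self _ ?_)
  refine div_nonneg (mul_nonneg hν ?_) (integral_exp_neg_sq_pos he).le
  exact integral_nonneg he.le fun η _ => by positivity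

/-- The mean of `exp (η X - η² Λ)` is bounded from below by the contribution of the learning rates
in `[η₀ / 2, η₀]`. -/
lemma le_integral_potential {e η₀ X Λ : ℝ} (hη₀ : 0 < η₀) (hη₀e : η₀ ≤ e) (hX : 0 ≤ X)
    (hΛ : 0 ≤ Λ) :
    η₀ / 2 * Real.exp (η₀ * X / 2 - η₀ ^ 2 * (Λ + 1)) ≤
      ∫ η in (0 : ℝ)..e, Real.exp (η * X - η ^ 2 * Λ) * Real.exp (-η ^ 2) := by
  have hcont : Continuous fun η : ℝ => Real.exp (η * X - η ^ 2 * Λ) * Real.exp (-η ^ 2) := by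
    fun_prop
  calc η₀ / 2 * Real.exp (η₀ * X / 2 - η₀ ^ 2 * (Λ + 1))
      = ∫ _η in (η₀ / 2)..η₀, Real.exp (η₀ * X / 2 - η₀ ^ 2 * (Λ + 1)) := by
        rw [intervalIntegral.integral_const, smul_eq_mul]; ring
    _ ≤ ∫ η in (η₀ / 2)..η₀, Real.exp (η * X - η ^ 2 * Λ) * Real.exp (-η ^ 2) := by
        refine integral_mono_on (by linarith) (Continuous.intervalIntegrable (by fun_prop) _ _)
          (hcont.intervalIntegrable _ _) fun η hη => ?_
        rw [← Real.exp_add, Real.exp_le_exp]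
        have h1 : η ^ 2 ≤ η₀ ^ 2 := by
          have := hη.1
          gcongr
          · linarith
          · exact hη.2
        nlinarith [mul_le_mul_of_nonneg_right h1 (by linarith : 0 ≤ Λ + 1),
          mul_le_mul_of_nonneg_right hη.1 hX]
    _ ≤ _ := by
        refine integral_mono_interval (by linarith) (by linarith) hη₀e
          (Filter.Eventually.of_forall fun η => by positivity) (hcont.intervalIntegrable _ _)

/-- The regret of the scale against `U`. The learning rate `η₀` and the level `M` are free, so that
they can be chosen from expectations although the lag is random. -/
lemma DelayPattern.sum_mul_meanScale_sub_le (hP : DelayPattern R S γ D) {h : Fin T → ℝ}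
    (hB : 0 ≤ B) (hh : ∀ t ∈ R, |h t| ≤ B) {e ν : ℝ} (he : 0 < e) (hν : 0 < ν)
    (heB : e * (B * (1 + 2 * D)) ≤ 1 / 20) {U η₀ M : ℝ} (hU : 0 < U) (hη₀ : 0 < η₀)
    (hη₀e : η₀ ≤ e) (hM : 0 ≤ M)
    (hUM : 4 * U * (∫ η in (0 : ℝ)..e, Real.exp (-η ^ 2)) ≤ ν * η₀ ^ 2 * Real.exp M) :
    ∑ t ∈ R, h t * (meanScale S γ e ν h t - U) ≤
      ν + 2 * U / η₀ * (M + η₀ ^ 2 * (∑ t ∈ R, lag γ (fun s => |h s|) t + 1)) := by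
  set Λ := ∑ t ∈ R, lag γ (fun s => |h s|) t with hΛ
  set Z := ∫ η in (0 : ℝ)..e, Real.exp (-η ^ 2) with hZdef
  have hZ : 0 < Z := integral_exp_neg_sq_pos he
  have hΛ0 : 0 ≤ Λ := Finset.sum_nonneg fun t ht =>
    hP.lag_nonneg (a := fun s => |h s|) (fun _ _ => abs_nonneg _) ht
  obtain ⟨X, hX⟩ : ∃ X, X = -∑ t ∈ R, h t := ⟨_, rfl⟩
  have hsplit : ∑ t ∈ R, h t * (meanScale S γ e ν h t - U) =
      ∑ t ∈ R, h t * meanScale S γ e ν h t + U * X := by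
    rw [hX, mul_neg, Finset.mul_sum, ← sub_eq_add_neg, ← Finset.sum_sub_distrib]
    exact Finset.sum_congr rfl fun t _ => by ring
  have hpos : 0 ≤ 2 * U / η₀ * (M + η₀ ^ 2 * (Λ + 1)) := by positivity
  rw [hsplit]
  rcases le_or_gt 0 X with hX0 | hX0
  · have h1 := hP.sum_mul_meanScale_le hB hh he hν.le heB
    have h2 := le_integral_potential (e := e) hη₀ hη₀e hX0 hΛ0
    have e1 : ∀ η : ℝ, Real.exp (-(η * ∑ t ∈ R, h t + η ^ 2 * Λ)) =
        Real.exp (η * X - η ^ 2 * Λ) := fun η => by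
      rw [hX]; congr 1; ring
    simp only [← hΛ, e1, ← hZdef] at h1
    -- the exponential is replaced by its tangent at the point where its slope is `U`
    have h3 : 2 * U / η₀ * (1 + (η₀ * X / 2 - η₀ ^ 2 * (Λ + 1) - M)) ≤
        ν * (η₀ / 2 * Real.exp (η₀ * X / 2 - η₀ ^ 2 * (Λ + 1))) / Z := by
      have h4 := Real.add_one_le_exp (η₀ * X / 2 - η₀ ^ 2 * (Λ + 1) - M)
      have h5 : 2 * U / η₀ * Real.exp (η₀ * X / 2 - η₀ ^ 2 * (Λ + 1) - M) ≤
          ν * (η₀ / 2 * Real.exp (η₀ * X / 2 - η₀ ^ 2 * (Λ + 1))) / Z := by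
        rw [Real.exp_sub _ M, div_mul_div_comm, div_le_div_iff₀ (by positivity) hZ]
        have h6 := mul_le_mul_of_nonneg_right hUM
          (Real.exp_nonneg (η₀ * X / 2 - η₀ ^ 2 * (Λ + 1)))
        linarith
      refine le_trans ?_ h5
      refine mul_le_mul_of_nonneg_left (by linarith) (by positivity)
    have h7 : ν * (η₀ / 2 * Real.exp (η₀ * X / 2 - η₀ ^ 2 * (Λ + 1))) / Z ≤
        ν * (∫ η in (0 : ℝ)..e, Real.exp (η * X - η ^ 2 * Λ) * Real.exp (-η ^ 2)) / Z := by
      gcongr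
    have h8 : 2 * U / η₀ * (1 + (η₀ * X / 2 - η₀ ^ 2 * (Λ + 1) - M)) =
        2 * U / η₀ + U * X - 2 * U / η₀ * (M + η₀ ^ 2 * (Λ + 1)) := by
      field_simp
      ring
    have h9 : 0 < 2 * U / η₀ := by positivity
    linarith
  · have h1 := hP.sum_mul_meanScale_le_const hB hh he hν.le heB
    have h2 : U * X ≤ 0 := mul_nonpos_of_nonneg_of_nonpos hU.le hX0.le
    linarith

end Scale

/-! ### The direction: dual averaging on the unit ball under delays -/

section Direction

variable {E : Type*} [NormedAddCommGroup E] [InnerProductSpace ℝ E]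

/-- The projection onto the closed unit ball. -/
noncomputable def ballProj (y : E) : E := (1 / max 1 ‖y‖) • y

lemma norm_ballProj_le (y : E) : ‖ballProj y‖ ≤ 1 := by
  have h : 0 < max 1 ‖y‖ := lt_of_lt_of_le one_pos (le_max_left _ _)
  rw [ballProj, norm_smul, Real.norm_of_nonneg (by positivity), one_div, inv_mul_le_iff₀ h,
    mul_one]
  exact le_max_right _ _

lemma ballProj_of_norm_le {y : E} (h : ‖y‖ ≤ 1) : ballProj y = y := by
  simp [ballProj, max_eq_left h]

lemma ballProj_of_one_le_norm {y : E} (h : 1 ≤ ‖y‖) : ballProj y = (1 / ‖y‖) • y := by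
  simp [ballProj, max_eq_right h]

lemma inner_sub_ballProj_le (y : E) {z : E} (hz : ‖z‖ ≤ 1) :
    inner ℝ (y - ballProj y) (z - ballProj y) ≤ 0 := by
  rcases le_total ‖y‖ 1 with h | h
  · simp [ballProj_of_norm_le h]
  · have hy : 0 < ‖y‖ := by linarith
    have e1 : y - ballProj y = (1 - 1 / ‖y‖) • y := by
      rw [ballProj_of_one_le_norm h, sub_smul, one_smul]
    have e2 : inner ℝ y (z - ballProj y) ≤ 0 := by
      rw [ballProj_of_one_le_norm h, inner_sub_right, inner_smul_right, real_inner_self_eq_norm_sq]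
      have h1 := real_inner_le_norm y z
      have h2 : 1 / ‖y‖ * ‖y‖ ^ 2 = ‖y‖ := by field_simp
      nlinarith
    rw [e1, inner_smul_left]
    have h3 : 0 ≤ 1 - 1 / ‖y‖ := by
      rw [sub_nonneg, div_le_one hy]; exact h
    exact mul_nonpos_of_nonneg_of_nonpos (by simpa using h3) e2

lemma norm_ballProj_sub_le (x y : E) : ‖ballProj x - ballProj y‖ ≤ ‖x - y‖ := by
  have h1 := inner_sub_ballProj_le x (norm_ballProj_le y)
  have h2 := inner_sub_ballProj_le y (norm_ballProj_le x)
  have h3 : ‖ballProj x - ballProj y‖ ^ 2 ≤ inner ℝ (x - y) (ballProj x - ballProj y) := by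
    rw [← real_inner_self_eq_norm_sq]
    have e : inner ℝ (x - y) (ballProj x - ballProj y)
        - inner ℝ (ballProj x - ballProj y) (ballProj x - ballProj y)
        = -inner ℝ (x - ballProj x) (ballProj y - ballProj x)
          - inner ℝ (y - ballProj y) (ballProj x - ballProj y) := by
      simp only [inner_sub_left, inner_sub_right]
      ring
    linarith
  have h4 := real_inner_le_norm (x - y) (ballProj x - ballProj y)
  by_contra! h5
  have : 0 < ‖ballProj x - ballProj y‖ := lt_of_le_of_lt (norm_nonneg _) h5
  nlinarith

lemma norm_ballProj_sub_ballProj_smul_le (y : E) {r : ℝ} (hr0 : 0 ≤ r) (hr1 : r ≤ 1) :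
    ‖ballProj y - ballProj (r • y)‖ ≤ 1 - r := by
  have hn : ‖r • y‖ = r * ‖y‖ := by rw [norm_smul, Real.norm_of_nonneg hr0]
  rcases le_total ‖y‖ 1 with h | h
  · have h1 : y - r • y = (1 - r) • y := by rw [sub_smul, one_smul]
    refine (norm_ballProj_sub_le _ _).trans ?_
    rw [h1, norm_smul, Real.norm_of_nonneg (by linarith)]
    nlinarith
  · have hy : 0 < ‖y‖ := by linarith
    rcases le_total ‖r • y‖ 1 with h2 | h2
    · have h3 : r ≤ 1 / ‖y‖ := by rw [le_div_iff₀ hy]; linarith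
      rw [ballProj_of_one_le_norm h, ballProj_of_norm_le h2, ← sub_smul, norm_smul,
        Real.norm_of_nonneg (by linarith), sub_mul, one_div, inv_mul_cancel₀ hy.ne']
      nlinarith
    · have hr : r ≠ 0 := by
        rintro rfl
        simp at h2
        linarith
      have : ballProj (r • y) = ballProj y := by
        rw [ballProj_of_one_le_norm h, ballProj_of_one_le_norm h2, hn, smul_smul]
        congr 1
        field_simp
      rw [this, sub_self, norm_zero]
      linarith

/-- The projection of `-ρ G` minimizes `⟪G, z⟫ + ‖z‖² / (2 ρ)` over the unit ball, with quadratic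
growth around the minimum. -/
lemma ballProj_minimizes (G : E) {ρ : ℝ} (hρ : 0 < ρ) {z : E} (hz : ‖z‖ ≤ 1) :
    inner ℝ G (ballProj (-(ρ • G))) + ‖ballProj (-(ρ • G))‖ ^ 2 / (2 * ρ) +
      ‖z - ballProj (-(ρ • G))‖ ^ 2 / (2 * ρ) ≤ inner ℝ G z + ‖z‖ ^ 2 / (2 * ρ) := by
  have h := inner_sub_ballProj_le (-(ρ • G)) hz
  set w := ballProj (-(ρ • G))
  rw [norm_sub_sq_real]
  simp only [inner_sub_left, inner_sub_right, inner_neg_left, inner_smul_left,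
    real_inner_self_eq_norm_sq, RCLike.conj_to_real] at h
  rw [← sub_nonneg]
  have : inner ℝ G z + ‖z‖ ^ 2 / (2 * ρ) - (inner ℝ G w + ‖w‖ ^ 2 / (2 * ρ) +
      (‖z‖ ^ 2 - 2 * inner ℝ z w + ‖w‖ ^ 2) / (2 * ρ)) =
      (ρ * inner ℝ G z - ρ * inner ℝ G w - ‖w‖ ^ 2 + inner ℝ z w) / ρ := by
    field_simp
    ring
  rw [this]
  refine div_nonneg ?_ hρ.le
  linarith [real_inner_comm w z, real_inner_comm z w]

variable {T : ℕ} {R : Finset (Fin T)} {S γ : Fin T → Finset (Fin T)} {D : ℕ} {B : ℝ}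

/-- Dual averaging with complete feedback and non-increasing learning rates `ρ`. -/
lemma sum_inner_dualAveraging_sub_le (R : Finset (Fin T)) (g : Fin T → E) {ρ : ℕ → ℝ}
    (hρ : ∀ k, 0 < ρ k) (hρm : ∀ k, ρ (k + 1) ≤ ρ k) (hρR : ∀ t : Fin T, t ∉ R → ρ (t + 1) = ρ t)
    {u : E} (hu : ‖u‖ ≤ 1) :
    ∑ t ∈ R, inner ℝ (g t) (ballProj (-(ρ t • sumBefore R g t)) - u) ≤
      1 / (2 * ρ T) + ∑ t ∈ R, ρ t * ‖g t‖ ^ 2 / 2 := by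
  -- the minimal value of the regularized cumulative loss serves as the potential
  set z : ℕ → E := fun k => ballProj (-(ρ k • sumBefore R g k)) with hz
  set P : ℕ → ℝ := fun k => inner ℝ (sumBefore R g k) (z k) + ‖z k‖ ^ 2 / (2 * ρ k) with hP
  have hstep : ∀ t ∈ R, inner ℝ (g t) (z t) - ρ t * ‖g t‖ ^ 2 / 2 ≤ P (t + 1) - P t := by
    intro t ht
    have h1 := ballProj_minimizes (sumBefore R g t) (hρ t) (norm_ballProj_le
      (-(ρ (t + 1) • sumBefore R g (t + 1))))
    change P t + ‖z (t + 1) - z t‖ ^ 2 / (2 * ρ t) ≤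
      inner ℝ (sumBefore R g t) (z (t + 1)) + ‖z (t + 1)‖ ^ 2 / (2 * ρ t) at h1
    have h2 : ‖z (t + 1)‖ ^ 2 / (2 * ρ t) ≤ ‖z (t + 1)‖ ^ 2 / (2 * ρ (t + 1)) := by
      have := hρ (t + 1)
      have := hρm t
      gcongr
    have h3 : P (t + 1) = inner ℝ (sumBefore R g t) (z (t + 1)) + inner ℝ (g t) (z (t + 1))
        + ‖z (t + 1)‖ ^ 2 / (2 * ρ (t + 1)) := by
      simp only [hP]
      rw [sumBefore_succ_of_mem g ht, inner_add_left]
    have h4 : inner ℝ (g t) (z t) - inner ℝ (g t) (z (t + 1)) ≤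
        ‖z (t + 1) - z t‖ ^ 2 / (2 * ρ t) + ρ t * ‖g t‖ ^ 2 / 2 := by
      rw [← inner_sub_right]
      refine (real_inner_le_norm _ _).trans ?_
      rw [norm_sub_rev (z t)]
      have h5 := hρ t
      have h6 : ‖z (t + 1) - z t‖ ^ 2 / (2 * ρ t) + ρ t * ‖g t‖ ^ 2 / 2
          - ‖g t‖ * ‖z (t + 1) - z t‖ = (‖z (t + 1) - z t‖ - ρ t * ‖g t‖) ^ 2 / (2 * ρ t) := by
        field_simp
        ring
      have h7 : 0 ≤ (‖z (t + 1) - z t‖ - ρ t * ‖g t‖) ^ 2 / (2 * ρ t) := by positivity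
      linarith
    linarith
  have hstep' : ∀ t : Fin T, t ∉ R → P (t + 1) = P t := by
    intro t ht
    simp only [hP, hz, sumBefore_succ_of_notMem g ht, hρR t ht]
  have h1 := sum_le_sub_of_step hstep hstep'
  have h0 : P 0 = 0 := by simp [hP, hz, sumBefore_zero, ballProj]
  have hT : P T ≤ ∑ t ∈ R, inner ℝ (g t) u + 1 / (2 * ρ T) := by
    have h2 := ballProj_minimizes (sumBefore R g T) (hρ T) hu
    have h3 : 0 ≤ ‖u - z T‖ ^ 2 / (2 * ρ T) := by
      have := hρ T
      positivity
    have h4 : ‖u‖ ^ 2 / (2 * ρ T) ≤ 1 / (2 * ρ T) := by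
      have := hρ T
      have : ‖u‖ ^ 2 ≤ 1 := by nlinarith [norm_nonneg u]
      gcongr
    have h5 : inner ℝ (sumBefore R g T) u = ∑ t ∈ R, inner ℝ (g t) u := by
      rw [sumBefore_last, sum_inner]
    rw [← h5]
    change P T + ‖u - z T‖ ^ 2 / (2 * ρ T) ≤ _ at h2
    linarith
  simp only [inner_sub_right, Finset.sum_sub_distrib] at h1 ⊢
  linarith

/-- The sum of the lags, each weighted with the inverse root of the preceding total, is of the
order of the root of the total. -/
lemma DelayPattern.sum_lag_div_sqrt_le (hP : DelayPattern R S γ D) {a : Fin T → ℝ}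
    (ha : ∀ t ∈ R, 0 ≤ a t) (haB : ∀ t ∈ R, a t ≤ B) (hB : 0 < B) :
    ∑ t ∈ R, lag γ a t / √(sumBefore R (lag γ a) t + B ^ 2 * (2 * (D : ℝ) + 1) ^ 2) ≤
      3 * √(∑ t ∈ R, lag γ a t + B ^ 2 * (2 * (D : ℝ) + 1) ^ 2) := by
  set c := B ^ 2 * (2 * (D : ℝ) + 1) ^ 2 with hc
  have hc0 : 0 < c := by positivity
  have h := sum_le_sub_of_step (R := R)
    (f := fun t => lag γ a t / √(sumBefore R (lag γ a) t + c))
    (P := fun k => 3 * √(sumBefore R (lag γ a) k + c)) (fun t ht => by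
      rw [sumBefore_succ_of_mem _ ht]
      set Λ := sumBefore R (lag γ a) t
      have hΛ : 0 ≤ Λ := sumBefore_nonneg (fun s hs => hP.lag_nonneg ha hs) _
      have hl0 := hP.lag_nonneg ha ht
      have hlc : lag γ a t ≤ c := by
        refine (hP.lag_le ha haB hB.le ht).trans ?_
        have h1 : a t * (B * (1 + 2 * D)) ≤ B * (B * (1 + 2 * D)) :=
          mul_le_mul_of_nonneg_right (haB t ht) (by positivity)
        have hD : (0 : ℝ) ≤ D := Nat.cast_nonneg D
        have h2 : B ^ 2 * (2 * (D : ℝ) + 1) ≤ B ^ 2 * (2 * (D : ℝ) + 1) ^ 2 := by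
          refine mul_le_mul_of_nonneg_left ?_ (sq_nonneg B)
          nlinarith
        nlinarith
      set l := lag γ a t
      have hs : 0 < √(Λ + c) := Real.sqrt_pos.2 (by linarith)
      have h1 : √(Λ + c) ≤ √(Λ + l + c) := Real.sqrt_le_sqrt (by linarith)
      have h2 : √(Λ + l + c) ≤ 2 * √(Λ + c) := by
        rw [Real.sqrt_le_left (by positivity), mul_pow, Real.sq_sqrt (by linarith)]
        linarith
      have e1 := Real.sq_sqrt (by linarith : 0 ≤ Λ + c)
      have e2 := Real.sq_sqrt (by linarith : 0 ≤ Λ + l + c)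
      rw [div_le_iff₀ hs]
      nlinarith)
    (fun t ht => by simp only [sumBefore_succ_of_notMem _ ht])
  simp only [sumBefore_last, sumBefore_zero] at h
  have := Real.sqrt_nonneg (0 + c)
  linarith

/-- The direction of AdaDelay-Dist, for delays at most `D` and gradients of norm at most `B`. -/
noncomputable def delayedDirection (S γ : Fin T → Finset (Fin T)) (D : ℕ) (B : ℝ) (g : Fin T → E)
    (t : Fin T) : E :=
  ballProj (-((1 / √(availableLag S γ (fun s => ‖g s‖) t + B ^ 2 * (2 * (D : ℝ) + 1) ^ 2)) •
    ∑ s ∈ S t, g s))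

/-- The direction differs from that of dual averaging with complete feedback both in the learning
rate and in the missing gradients; either difference is a multiple of the missing norms. -/
lemma DelayPattern.norm_delayedDirection_sub_le (hP : DelayPattern R S γ D) {g : Fin T → E}
    (hB : 0 < B) (hg : ∀ t ∈ R, ‖g t‖ ≤ B) {t : Fin T} (ht : t ∈ R) {ρ : ℝ}
    (hρ : ρ = 1 / √(sumBefore R (lag γ fun s => ‖g s‖) t + B ^ 2 * (2 * (D : ℝ) + 1) ^ 2)) :
    ‖delayedDirection S γ D B g t - ballProj (-(ρ • sumBefore R g t))‖ ≤
      3 * ρ * ∑ i ∈ γ t, ‖g i‖ := by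
  set c := B ^ 2 * (2 * (D : ℝ) + 1) ^ 2 with hc
  set a : Fin T → ℝ := fun s => ‖g s‖ with ha
  have ha0 : ∀ t ∈ R, 0 ≤ a t := fun _ _ => norm_nonneg _
  set Λ := sumBefore R (lag γ a) t with hΛdef
  set O := availableLag S γ a t with hOdef
  have hO : 0 ≤ O := hP.availableLag_nonneg ha0 ht
  have hOΛ : O ≤ Λ := hP.availableLag_le ha0 ht
  have hc0 : 0 < c := by positivity
  have hgap : Λ - O ≤ B * (1 + 4 * D) * ∑ i ∈ γ t, a i :=
    hP.sumBefore_lag_sub_availableLag_le ha0 hg hB.le ht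
  set H := ∑ i ∈ γ t, a i with hH
  have hH0 : 0 ≤ H := hP.sum_missing_nonneg ha0 ht
  have hsΛ : 0 < √(Λ + c) := Real.sqrt_pos.2 (by linarith)
  have hsO : 0 < √(O + c) := Real.sqrt_pos.2 (by linarith)
  have hρ0 : 0 < ρ := by rw [hρ]; positivity
  have hρB : ρ * (B * (2 * D + 1)) ≤ 1 := by
    rw [hρ, one_div, inv_mul_le_iff₀ hsΛ, mul_one]
    refine Real.le_sqrt_of_sq_le ?_
    rw [mul_pow]
    linarith
  -- the part due to the missing gradients
  have h1 : ‖ballProj (-(ρ • ∑ s ∈ S t, g s)) - ballProj (-(ρ • sumBefore R g t))‖ ≤ ρ * H := by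
    refine (norm_ballProj_sub_le _ _).trans ?_
    have : -(ρ • ∑ s ∈ S t, g s) - -(ρ • sumBefore R g t) = ρ • ∑ i ∈ γ t, g i := by
      rw [hP.sumBefore_eq g ht, smul_add]
      abel
    rw [this, norm_smul, Real.norm_of_nonneg hρ0.le]
    exact mul_le_mul_of_nonneg_left (norm_sum_le _ _) hρ0.le
  -- the part due to the learning rate
  set r := √(O + c) / √(Λ + c) with hr
  have hr0 : 0 ≤ r := by positivity
  have hr1 : r ≤ 1 := by
    rw [hr, div_le_one hsΛ]
    exact Real.sqrt_le_sqrt (by linarith)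
  have h2 : ‖ballProj (-((1 / √(O + c)) • ∑ s ∈ S t, g s)) -
      ballProj (-(ρ • ∑ s ∈ S t, g s))‖ ≤ 1 - r := by
    have : -(ρ • ∑ s ∈ S t, g s) = r • -((1 / √(O + c)) • ∑ s ∈ S t, g s) := by
      rw [smul_neg, smul_smul, hρ, hr]
      congr 2
      field_simp
    rw [this]
    exact norm_ballProj_sub_ballProj_smul_le _ hr0 hr1
  have h3 : 1 - r ≤ 2 * ρ * H := by
    have h4 : r ^ 2 = 1 - ρ ^ 2 * (Λ - O) := by
      rw [hr, hρ, div_pow, div_pow, Real.sq_sqrt (by linarith), Real.sq_sqrt (by linarith)]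
      have : Λ + c ≠ 0 := by linarith
      field_simp
      ring
    have h5 : 1 - r ≤ ρ ^ 2 * (Λ - O) := by nlinarith
    have h6 := mul_le_mul_of_nonneg_left hgap (sq_nonneg ρ)
    have h7 := mul_le_mul_of_nonneg_right hρB (mul_nonneg hρ0.le hH0)
    have h8 : 0 ≤ ρ * H * ρ * B := by positivity
    nlinarith
  calc _ = ‖(ballProj (-((1 / √(O + c)) • ∑ s ∈ S t, g s)) -
      ballProj (-(ρ • ∑ s ∈ S t, g s))) + (ballProj (-(ρ • ∑ s ∈ S t, g s)) -
        ballProj (-(ρ • sumBefore R g t)))‖ := by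
        rw [sub_add_sub_cancel]
        rfl
    _ ≤ (1 - r) + ρ * H := (norm_add_le _ _).trans (add_le_add h2 h1)
    _ ≤ 3 * ρ * H := by linarith

/-- The regret of AdaDelay-Dist on the unit ball. -/
lemma DelayPattern.sum_inner_delayedDirection_sub_le (hP : DelayPattern R S γ D) {g : Fin T → E}
    (hB : 0 < B) (hg : ∀ t ∈ R, ‖g t‖ ≤ B) {u : E} (hu : ‖u‖ ≤ 1) :
    ∑ t ∈ R, inner ℝ (g t) (delayedDirection S γ D B g t - u) ≤
      5 * √(∑ t ∈ R, lag γ (fun s => ‖g s‖) t + B ^ 2 * (2 * (D : ℝ) + 1) ^ 2) := by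
  set c := B ^ 2 * (2 * (D : ℝ) + 1) ^ 2 with hc
  have hc0 : 0 < c := by positivity
  set a : Fin T → ℝ := fun s => ‖g s‖ with ha
  have ha0 : ∀ t ∈ R, 0 ≤ a t := fun _ _ => norm_nonneg _
  have hlag0 : ∀ t ∈ R, 0 ≤ lag γ a t := fun t ht => hP.lag_nonneg ha0 ht
  set ρ : ℕ → ℝ := fun k => 1 / √(sumBefore R (lag γ a) k + c) with hρ
  have hpos : ∀ k, 0 < √(sumBefore R (lag γ a) k + c) := fun k =>
    Real.sqrt_pos.2 (by linarith [sumBefore_nonneg hlag0 k])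
  have hρ0 : ∀ k, 0 < ρ k := fun k => one_div_pos.2 (hpos k)
  have hDA := sum_inner_dualAveraging_sub_le R g hρ0
    (fun k => one_div_le_one_div_of_le (hpos k) (Real.sqrt_le_sqrt (by
      linarith [sumBefore_mono_of_nonneg hlag0 (Nat.le_succ k)])))
    (fun t ht => by simp only [hρ, sumBefore_succ_of_notMem _ ht]) hu
  have hterm : ∀ t ∈ R, inner ℝ (g t) (delayedDirection S γ D B g t - u) ≤
      inner ℝ (g t) (ballProj (-(ρ t • sumBefore R g t)) - u) +
        3 * ρ t * a t * ∑ i ∈ γ t, a i := by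
    intro t ht
    have h1 := hP.norm_delayedDirection_sub_le hB hg ht (ρ := ρ t) rfl
    have h2 := real_inner_le_norm (g t)
      (delayedDirection S γ D B g t - ballProj (-(ρ t • sumBefore R g t)))
    have h3 := mul_le_mul_of_nonneg_left h1 (norm_nonneg (g t))
    simp only [inner_sub_right] at h2 ⊢
    have h4 : ‖g t‖ * (3 * ρ t * ∑ i ∈ γ t, ‖g i‖) = 3 * ρ t * a t * ∑ i ∈ γ t, a i := by
      simp only [ha]; ring
    linarith
  have h1 := Finset.sum_le_sum hterm
  rw [Finset.sum_add_distrib] at h1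
  have h2 : ∑ t ∈ R, ρ t * ‖g t‖ ^ 2 / 2 + ∑ t ∈ R, 3 * ρ t * a t * ∑ i ∈ γ t, a i ≤
      3 / 2 * ∑ t ∈ R, lag γ a t / √(sumBefore R (lag γ a) t + c) := by
    rw [← Finset.sum_add_distrib, Finset.mul_sum]
    refine Finset.sum_le_sum fun t ht => ?_
    have e : lag γ a t / √(sumBefore R (lag γ a) t + c) = ρ t * lag γ a t := by
      simp only [hρ]; ring
    rw [e, lag]
    change ρ t * a t ^ 2 / 2 + _ ≤ _
    nlinarith [mul_nonneg (hρ0 t).le (sq_nonneg (a t))]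
  have h3 := hP.sum_lag_div_sqrt_le ha0 hg hB
  rw [← hc] at h3
  have h4 : 1 / (2 * ρ T) = √(∑ t ∈ R, lag γ a t + c) / 2 := by
    simp only [hρ, sumBefore_last]
    field_simp
  have := Real.sqrt_nonneg (∑ t ∈ R, lag γ a t + c)
  linarith

end Direction

/-! ### Expectations over adaptively drawn sequences -/

section Expectation

variable {T : ℕ} {Ω : Type*} [Fintype Ω]

/-- The expectation of `f` over sequences whose entry `t` has the law `κ t h`, where `h` is the
sequence itself; for adapted `κ` only its earlier entries matter. -/
def seqExpect (κ : Fin T → (Fin T → Ω) → Ω → ℝ) (f : (Fin T → Ω) → ℝ) : ℝ :=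
  ∑ h, (∏ t, κ t h (h t)) * f h

/-- The function `f` depends only on the entries before entry `k`. -/
def DependsBefore {β : Type*} (f : (Fin T → Ω) → β) (k : ℕ) : Prop :=
  ∀ h h', (∀ s : Fin T, (s : ℕ) < k → h s = h' s) → f h = f h'

/-- Entry `t` is drawn from a law of total mass one that depends only on the earlier entries. -/
structure IsAdaptedLaw (κ : Fin T → (Fin T → Ω) → Ω → ℝ) : Prop where
  adapted : ∀ t, DependsBefore (κ t) t
  sum_eq_one : ∀ t h, ∑ c, κ t h c = 1
  nonneg : ∀ t h c, 0 ≤ κ t h c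

variable {κ : Fin T → (Fin T → Ω) → Ω → ℝ}

lemma seqExpect_add (f g : (Fin T → Ω) → ℝ) :
    seqExpect κ (fun h => f h + g h) = seqExpect κ f + seqExpect κ g := by
  simp only [seqExpect, mul_add, Finset.sum_add_distrib]

lemma seqExpect_const_mul (c : ℝ) (f : (Fin T → Ω) → ℝ) :
    seqExpect κ (fun h => c * f h) = c * seqExpect κ f := by
  simp only [seqExpect, Finset.mul_sum]
  exact Finset.sum_congr rfl fun h _ => by ring

lemma seqExpect_sum {ι : Type*} (s : Finset ι) (f : ι → (Fin T → Ω) → ℝ) :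
    seqExpect κ (fun h => ∑ i ∈ s, f i h) = ∑ i ∈ s, seqExpect κ (f i) := by
  simp only [seqExpect, Finset.mul_sum]
  exact Finset.sum_comm

lemma IsAdaptedLaw.seqExpect_mono (hκ : IsAdaptedLaw κ) {f g : (Fin T → Ω) → ℝ}
    (h : ∀ x, f x ≤ g x) : seqExpect κ f ≤ seqExpect κ g :=
  Finset.sum_le_sum fun x _ => mul_le_mul_of_nonneg_left (h x)
    (Finset.prod_nonneg fun t _ => hκ.nonneg t x (x t))

/-- Resampling one entry uniformly preserves the uniform distribution on sequences. -/
lemma card_mul_sum_eq_sum_update (t : Fin T) (F : (Fin T → Ω) → ℝ) :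
    (Fintype.card Ω : ℝ) * ∑ h, F h = ∑ h, ∑ c, F (Function.update h t c) := by
  rw [← Fintype.sum_prod_type']
  have hinv : Function.Involutive
      fun x : (Fin T → Ω) × Ω => (Function.update x.1 t x.2, x.1 t) := by
    rintro ⟨h, c⟩
    simp
  have := Equiv.sum_comp hinv.toPerm (fun x : (Fin T → Ω) × Ω => F x.1)
  simp only [Function.Involutive.coe_toPerm] at this
  rw [this, Fintype.sum_prod_type]
  simp [Finset.mul_sum]

/-- The expectation in which only the entries before entry `k` follow their laws and the others
are uniform, scaled by the number of sequences. -/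
noncomputable def partialExpect (κ : Fin T → (Fin T → Ω) → Ω → ℝ) (k : ℕ)
    (f : (Fin T → Ω) → ℝ) : ℝ :=
  (Fintype.card Ω : ℝ) ^ k *
    ∑ h, (∏ t ∈ Finset.univ.filter (fun t : Fin T => (t : ℕ) < k), κ t h (h t)) * f h

lemma partialExpect_last (f : (Fin T → Ω) → ℝ) :
    partialExpect κ T f = (Fintype.card Ω : ℝ) ^ T * seqExpect κ f := by
  simp [partialExpect, seqExpect]

lemma IsAdaptedLaw.partialExpect_succ (hκ : IsAdaptedLaw κ) (t : Fin T)
    (f : (Fin T → Ω) → ℝ) : partialExpect κ (t + 1) f =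
      partialExpect κ t fun h => ∑ c, κ t h c * f (Function.update h t c) := by
  classical
  rw [partialExpect, partialExpect, pow_succ, mul_assoc, card_mul_sum_eq_sum_update t]
  congr 1
  refine Finset.sum_congr rfl fun h _ => ?_
  rw [Finset.mul_sum]
  refine Finset.sum_congr rfl fun c _ => ?_
  have hset : Finset.univ.filter (fun s : Fin T => (s : ℕ) < t + 1) =
      insert t (Finset.univ.filter fun s : Fin T => (s : ℕ) < t) := by
    ext s
    simp only [Finset.mem_filter, Finset.mem_univ, true_and, Finset.mem_insert, Fin.ext_iff]
    omega
  have hupd : ∀ s : Fin T, (s : ℕ) ≤ t → κ s (Function.update h t c) = κ s h := by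
    intro s hs
    refine hκ.adapted s _ _ fun s' hs' => ?_
    rw [Function.update_of_ne]
    rintro rfl
    omega
  rw [hset, Finset.prod_insert (by simp), hupd t le_rfl, Function.update_self]
  have : ∏ s ∈ Finset.univ.filter (fun s : Fin T => (s : ℕ) < t),
      κ s (Function.update h t c) (Function.update h t c s) =
      ∏ s ∈ Finset.univ.filter (fun s : Fin T => (s : ℕ) < t), κ s h (h s) := by
    refine Finset.prod_congr rfl fun s hs => ?_
    have hs' : (s : ℕ) < t := (Finset.mem_filter.1 hs).2
    rw [hupd s hs'.le, Function.update_of_ne]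
    rintro rfl
    omega
  rw [this]
  ring

lemma IsAdaptedLaw.partialExpect_eq (hκ : IsAdaptedLaw κ) {f : (Fin T → Ω) → ℝ} {k : ℕ}
    (hf : DependsBefore f k) (hk : k ≤ T) :
    partialExpect κ k f = partialExpect κ T f := by
  have : ∀ l, k ≤ l → l ≤ T → partialExpect κ l f = partialExpect κ k f := by
    intro l hl
    induction l, hl using Nat.le_induction with
    | base => intro _; rfl
    | succ l hl ih =>
      intro hlT
      rw [← ih (by omega)]
      have := hκ.partialExpect_succ ⟨l, by omega⟩ f
      simp only at this
      rw [this]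
      congr 1
      ext h
      have e : ∀ c, f (Function.update h ⟨l, by omega⟩ c) = f h := fun c => by
        refine hf _ _ fun s hs => ?_
        rw [Function.update_of_ne]
        rintro rfl
        simp only at hs
        omega
      simp only [e]
      rw [← Finset.sum_mul, hκ.sum_eq_one, one_mul]
  exact (this T hk le_rfl).symm

/-- Conditioning on the entries before entry `t`. -/
lemma IsAdaptedLaw.seqExpect_tower [Nonempty Ω] (hκ : IsAdaptedLaw κ) (t : Fin T)
    {f : (Fin T → Ω) → ℝ} (hf : DependsBefore f (t + 1)) :
    seqExpect κ f = seqExpect κ fun h => ∑ c, κ t h c * f (Function.update h t c) := by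
  have hg : DependsBefore (fun h => ∑ c, κ t h c * f (Function.update h t c)) t := by
    intro h h' e
    refine Finset.sum_congr rfl fun c _ => ?_
    rw [hκ.adapted t h h' e]
    congr 1
    refine hf _ _ fun s hs => ?_
    by_cases hst : s = t
    · subst hst; simp
    · rw [Function.update_of_ne hst, Function.update_of_ne hst]
      have : (s : ℕ) ≠ t := fun h => hst (Fin.ext h)
      exact e s (by omega)
  have h1 := hκ.partialExpect_eq hf t.2
  rw [hκ.partialExpect_succ, hκ.partialExpect_eq hg t.2.le, partialExpect_last,
    partialExpect_last] at h1
  have hc : (Fintype.card Ω : ℝ) ^ T ≠ 0 := by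
    have : (Fintype.card Ω : ℝ) ≠ 0 := by exact_mod_cast Fintype.card_ne_zero
    positivity
  exact (mul_left_cancel₀ hc h1).symm

lemma IsAdaptedLaw.seqExpect_const [Nonempty Ω] (hκ : IsAdaptedLaw κ) (c : ℝ) :
    seqExpect κ (fun _ => c) = c := by
  have h1 := hκ.partialExpect_eq (f := fun _ => c) (k := 0) (fun _ _ _ => rfl) (Nat.zero_le _)
  rw [partialExpect_last] at h1
  have hc : (Fintype.card Ω : ℝ) ^ T ≠ 0 := by
    have : (Fintype.card Ω : ℝ) ≠ 0 := by exact_mod_cast Fintype.card_ne_zero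
    positivity
  refine mul_left_cancel₀ hc (h1.symm.trans ?_)
  simp [partialExpect]

section Independent

variable [Nonempty Ω] {p : Ω → ℝ}

omit [Nonempty Ω] in
lemma isAdaptedLaw_const (hp : ∑ c, p c = 1) (hp0 : ∀ c, 0 ≤ p c) :
    IsAdaptedLaw (fun (_ : Fin T) (_ : Fin T → Ω) => p) :=
  ⟨fun _ _ _ _ => rfl, fun _ _ => hp, fun _ _ => hp0⟩

lemma seqExpect_apply (hp : ∑ c, p c = 1) (hp0 : ∀ c, 0 ≤ p c) (φ : Ω → ℝ) (i : Fin T) :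
    seqExpect (fun _ _ => p) (fun h : Fin T → Ω => φ (h i)) = ∑ c, p c * φ c := by
  have hκ := isAdaptedLaw_const (T := T) hp hp0
  rw [hκ.seqExpect_tower i (fun h h' e => by rw [e i (by omega)])]
  simp only [Function.update_self]
  exact hκ.seqExpect_const _

lemma seqExpect_apply_mul_apply (hp : ∑ c, p c = 1) (hp0 : ∀ c, 0 ≤ p c) (φ : Ω → ℝ)
    {i j : Fin T} (hij : i ≠ j) :
    seqExpect (fun _ _ => p) (fun h : Fin T → Ω => φ (h i) * φ (h j)) =
      (∑ c, p c * φ c) ^ 2 := by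
  have hκ := isAdaptedLaw_const (T := T) hp hp0
  wlog hlt : i < j generalizing i j
  · rw [← this hij.symm (lt_of_le_of_ne (not_lt.1 hlt) hij.symm)]
    congr 1
    ext h
    ring
  rw [hκ.seqExpect_tower j (fun h h' e => by
    rw [e i (by have : (i : ℕ) < j := hlt; omega), e j (by omega)])]
  simp only [Function.update_self, Function.update_of_ne hij]
  have : ∀ h : Fin T → Ω, ∑ c, p c * (φ (h i) * φ c) = (∑ c, p c * φ c) * φ (h i) := fun h => by
    rw [Finset.sum_mul]
    exact Finset.sum_congr rfl fun c _ => by ring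
  simp only [this]
  rw [seqExpect_const_mul, seqExpect_apply hp hp0, sq]

/-- The second moment of a sum of independent copies. -/
lemma seqExpect_sum_sq_le (hp : ∑ c, p c = 1) (hp0 : ∀ c, 0 ≤ p c) (φ : Ω → ℝ) :
    seqExpect (fun _ _ => p) (fun h : Fin T → Ω => (∑ i, φ (h i)) ^ 2) ≤
      T * ∑ c, p c * φ c ^ 2 + T ^ 2 * (∑ c, p c * φ c) ^ 2 := by
  classical
  simp only [sq (∑ i, φ _), Finset.sum_mul_sum]
  rw [seqExpect_sum]
  have : ∀ i : Fin T, seqExpect (fun _ _ => p)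
      (fun h : Fin T → Ω => ∑ j, φ (h i) * φ (h j)) ≤
      ∑ c, p c * φ c ^ 2 + T * (∑ c, p c * φ c) ^ 2 := by
    intro i
    rw [seqExpect_sum, ← Finset.add_sum_erase _ _ (Finset.mem_univ i)]
    refine add_le_add (le_of_eq ?_) ?_
    · have := seqExpect_apply (T := T) hp hp0 (fun c => φ c ^ 2) i
      simpa only [sq] using this
    · rw [Finset.sum_congr rfl fun j hj =>
        seqExpect_apply_mul_apply hp hp0 φ (Finset.ne_of_mem_erase hj).symm, Finset.sum_const,
        nsmul_eq_mul]
      refine mul_le_mul_of_nonneg_right ?_ (sq_nonneg _)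
      have := Finset.card_le_univ (Finset.univ.erase i)
      rw [Fintype.card_fin] at this
      exact_mod_cast this
  refine (Finset.sum_le_sum fun i _ => this i).trans (le_of_eq ?_)
  rw [Finset.sum_const, Finset.card_univ, Fintype.card_fin, nsmul_eq_mul]
  ring

end Independent

end Expectation

/-! ### Sparsified quantization: unbiasedness and second moment -/

section EncodingMoments

variable {d m : ℕ} {G : ℝ}

lemma level_lt (d : ℕ) (G y : ℝ) : level d G y < 2 ^ precision d := by
  have : 0 < 2 ^ precision d := by positivity
  unfold level
  omega

lemma bitProb_nonneg (hG : 0 < G) (y : ℝ) : 0 ≤ bitProb d G y := by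
  rw [bitProb, sub_nonneg]
  calc ((level d G y : ℕ) : ℝ) ≤ ⌊2 ^ precision d * |y| / G⌋₊ := by
        exact Nat.cast_le.2 (min_le_left _ _)
    _ ≤ _ := Nat.floor_le (by positivity)

lemma bitProb_le_one (hG : 0 < G) {y : ℝ} (hy : |y| ≤ G) : bitProb d G y ≤ 1 := by
  rw [bitProb, sub_le_iff_le_add', level]
  have h2 : 2 ^ precision d * |y| / G ≤ 2 ^ precision d := by
    rw [div_le_iff₀ hG]
    gcongr
  rcases le_total ⌊2 ^ precision d * |y| / G⌋₊ (2 ^ precision d - 1) with h | h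
  · rw [min_eq_left h]
    exact (Nat.lt_floor_add_one _).le
  · rw [min_eq_right h, Nat.cast_sub Nat.one_le_two_pow]
    push_cast
    linarith

/-- The symbol for the coordinate `i` of `x` and the Bernoulli bit `β`. -/
noncomputable def symbolOf (G : ℝ) (x : Vec d) (i : Fin d) (β : Bool) : CodeSymbol d :=
  (i, decide (x i < 0), ⟨level d G (x i), level_lt d G (x i)⟩, β)

/-- Sums weighted with the law of a symbol, as averages over the coordinate and the bit. -/
lemma sum_symbolProb_mul (x : Vec d) (f : CodeSymbol d → ℝ) :
    ∑ c, symbolProb G x c * f c = 1 / (d : ℝ) * ∑ i, (bitProb d G (x i) * f (symbolOf G x i true) +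
      (1 - bitProb d G (x i)) * f (symbolOf G x i false)) := by
  rw [Fintype.sum_prod_type, Finset.mul_sum]
  refine Finset.sum_congr rfl fun i _ => ?_
  rw [Fintype.sum_prod_type, Finset.sum_eq_single (decide (x i < 0)), Fintype.sum_prod_type,
    Finset.sum_eq_single ⟨level d G (x i), level_lt d G (x i)⟩]
  · simp [symbolProb, symbolOf]
    ring
  · intro l _ hl
    have : (l : ℕ) ≠ level d G (x i) := fun h => hl (Fin.ext h)
    simp [symbolProb, this]
  · simp
  · intro s _ hs
    refine Finset.sum_eq_zero fun c _ => ?_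
    have : ¬(s = true ↔ x i < 0) := fun h => hs (by
      by_cases hx : x i < 0 <;> cases s <;> simp_all)
    simp [symbolProb, this]
  · simp

lemma symbolProb_nonneg (hG : 0 < G) {x : Vec d} (hx : ‖x‖ ≤ G) (c : CodeSymbol d) :
    0 ≤ symbolProb G x c := by
  have h1 := bitProb_nonneg (d := d) hG (x c.1)
  have h2 := bitProb_le_one (d := d) hG ((PiLp.norm_apply_le x c.1).trans hx)
  unfold symbolProb
  split_ifs
  · positivity
  · exact mul_nonneg (by positivity) (by linarith)
  · exact le_rfl

lemma sum_symbolProb (hd : 1 ≤ d) (x : Vec d) : ∑ c, symbolProb G x c = 1 := by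
  have h := sum_symbolProb_mul (G := G) x (fun _ => 1)
  have hd' : (d : ℝ) ≠ 0 := by positivity
  simpa [hd'] using h

/-- The Bernoulli bit makes the quantized entry unbiased. -/
lemma symbolValue_mean (hG : 0 < G) (x : Vec d) (i : Fin d) :
    bitProb d G (x i) * symbolValue G (symbolOf G x i true) +
      (1 - bitProb d G (x i)) * symbolValue G (symbolOf G x i false) = x i := by
  have hq : bitProb d G (x i) + level d G (x i) = 2 ^ precision d * |x i| / G := by
    rw [bitProb]; ring
  have e : G / 2 ^ precision d * (bitProb d G (x i) + level d G (x i)) = |x i| := by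
    rw [hq]
    field_simp
  simp only [symbolValue, symbolOf, decide_eq_true_eq, if_true, Bool.false_eq_true, if_false]
  by_cases h : x i < 0
  · rw [abs_of_neg h] at e
    simp only [h, if_true]
    linarith
  · rw [abs_of_nonneg (not_lt.1 h)] at e
    simp only [h, if_false]
    linarith

lemma symbolValue_second_moment_le (hG : 0 < G) (x : Vec d) (i : Fin d) :
    bitProb d G (x i) * symbolValue G (symbolOf G x i true) ^ 2 +
      (1 - bitProb d G (x i)) * symbolValue G (symbolOf G x i false) ^ 2 ≤
      x i ^ 2 + (G / 2 ^ precision d) ^ 2 / 4 := by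
  have h := symbolValue_mean hG x i
  set q := bitProb d G (x i)
  set α := symbolValue G (symbolOf G x i true) with hα
  set β := symbolValue G (symbolOf G x i false) with hβ
  have hαβ : (α - β) ^ 2 = (G / 2 ^ precision d) ^ 2 := by
    rw [hα, hβ]
    simp only [symbolValue, symbolOf, decide_eq_true_eq, if_true, Bool.false_eq_true, if_false]
    split_ifs <;> ring
  rw [← hαβ, ← h]
  have : (q * α + (1 - q) * β) ^ 2 + (α - β) ^ 2 / 4 - (q * α ^ 2 + (1 - q) * β ^ 2) =
      (α - β) ^ 2 * (q - 1 / 2) ^ 2 := by ring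
  nlinarith [mul_nonneg (sq_nonneg (α - β)) (sq_nonneg (q - 1 / 2))]

lemma abs_symbolValue_le (hG : 0 < G) (c : CodeSymbol d) : |symbolValue G c| ≤ G := by
  have h1 : ((c.2.2.1 : ℕ) : ℝ) + 1 ≤ 2 ^ precision d := by exact_mod_cast c.2.2.1.2
  have h0 : (0 : ℝ) ≤ ((c.2.2.1 : ℕ) : ℝ) := Nat.cast_nonneg _
  have h2 : G / 2 ^ precision d * (((c.2.2.1 : ℕ) : ℝ) + if c.2.2.2 = true then 1 else 0) ≤ G := by
    calc _ ≤ G / 2 ^ precision d * 2 ^ precision d := by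
          refine mul_le_mul_of_nonneg_left ?_ (by positivity)
          split_ifs <;> linarith
      _ = G := by field_simp
  have h3 : 0 ≤ G / 2 ^ precision d *
      (((c.2.2.1 : ℕ) : ℝ) + if c.2.2.2 = true then 1 else 0) := by
    refine mul_nonneg (by positivity) ?_
    split_ifs <;> linarith
  unfold symbolValue
  rw [mul_assoc, abs_mul, abs_of_nonneg h3]
  split_ifs at * <;> simpa using h2

/-- Entry `k` of `d` times the quantized entry in the sampled direction. -/
noncomputable def symbolEntry (G : ℝ) (k : Fin d) (c : CodeSymbol d) : ℝ :=
  if c.1 = k then (d : ℝ) * symbolValue G c else 0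

lemma decode_apply (c : Codeword d m) (k : Fin d) :
    decode G c k = 1 / (m : ℝ) * ∑ i, symbolEntry G k (c i) := by
  simp [decode, symbolEntry, Pi.single_apply, eq_comm]

lemma norm_decode_le (hG : 0 < G) (c : Codeword d m) : ‖decode G c‖ ≤ d * G := by
  have hdG : 0 ≤ (d : ℝ) * G := by positivity
  rw [decode, norm_smul, Real.norm_of_nonneg (by positivity)]
  have h : ‖∑ i, EuclideanSpace.single (c i).1 ((d : ℝ) * symbolValue G (c i))‖ ≤
      (m : ℝ) * (d * G) := by
    refine (norm_sum_le _ _).trans ?_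
    calc _ ≤ ∑ _i : Fin m, (d : ℝ) * G := by
          refine Finset.sum_le_sum fun i _ => ?_
          rw [PiLp.norm_single, Real.norm_eq_abs, abs_mul, abs_of_nonneg (Nat.cast_nonneg d)]
          exact mul_le_mul_of_nonneg_left (abs_symbolValue_le hG _) (Nat.cast_nonneg d)
      _ = _ := by simp
  rcases Nat.eq_zero_or_pos m with rfl | hm
  · simpa using hdG
  · have hm' : (0 : ℝ) < m := by exact_mod_cast hm
    rw [one_div, inv_mul_le_iff₀ hm']
    exact h

lemma sum_symbolProb_mul_symbolEntry (hG : 0 < G) (hd : 1 ≤ d) (x : Vec d) (k : Fin d) :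
    ∑ c, symbolProb G x c * symbolEntry G k c = x k := by
  have hd' : (d : ℝ) ≠ 0 := by positivity
  rw [sum_symbolProb_mul, Finset.sum_eq_single k]
  · have h := symbolValue_mean hG x k
    have e : ∀ β, symbolEntry G k (symbolOf G x k β) = d * symbolValue G (symbolOf G x k β) :=
      fun β => by simp [symbolEntry, symbolOf]
    rw [e, e]
    nth_rewrite 3 [← h]
    field_simp
  · intro i _ hi
    simp [symbolEntry, symbolOf, hi]
  · simp

lemma sum_symbolProb_mul_symbolEntry_sq_le (hG : 0 < G) (hd : 1 ≤ d) (x : Vec d) (k : Fin d) :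
    ∑ c, symbolProb G x c * symbolEntry G k c ^ 2 ≤
      d * (x k ^ 2 + (G / 2 ^ precision d) ^ 2 / 4) := by
  have hd' : (d : ℝ) ≠ 0 := by positivity
  rw [sum_symbolProb_mul, Finset.sum_eq_single k]
  · have h := symbolValue_second_moment_le hG x k
    have e : ∀ β, symbolEntry G k (symbolOf G x k β) = d * symbolValue G (symbolOf G x k β) :=
      fun β => by simp [symbolEntry, symbolOf]
    rw [e, e]
    refine le_trans (le_of_eq ?_) (mul_le_mul_of_nonneg_left h (Nat.cast_nonneg d))
    field_simp
  · intro i _ hi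
    simp [symbolEntry, symbolOf, hi]
  · simp

lemma encodeProb_nonneg (hG : 0 < G) {x : Vec d} (hx : ‖x‖ ≤ G) (c : Codeword d m) :
    0 ≤ encodeProb G x c :=
  Finset.prod_nonneg fun _ _ => symbolProb_nonneg hG hx _

lemma sum_encodeProb_mul (x : Vec d) (f : Codeword d m → ℝ) :
    ∑ c, encodeProb G x c * f c = seqExpect (fun _ _ => symbolProb G x) f := rfl

lemma nonempty_codeSymbol (hd : 1 ≤ d) : Nonempty (CodeSymbol d) :=
  ⟨⟨0, hd⟩, true, ⟨0, by positivity⟩, true⟩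

lemma sum_encodeProb (hG : 0 < G) (hd : 1 ≤ d) {x : Vec d} (hx : ‖x‖ ≤ G) :
    ∑ c : Codeword d m, encodeProb G x c = 1 := by
  have := nonempty_codeSymbol hd
  have h := (isAdaptedLaw_const (T := m) (sum_symbolProb (G := G) hd x)
    (symbolProb_nonneg hG hx)).seqExpect_const 1
  rw [← sum_encodeProb_mul] at h
  simpa using h

/-- The decoded vector is an unbiased estimate. -/
lemma sum_encodeProb_mul_inner_decode (hG : 0 < G) (hd : 1 ≤ d) (hm : 1 ≤ m) {x : Vec d}
    (hx : ‖x‖ ≤ G) (w : Vec d) :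
    ∑ c : Codeword d m, encodeProb G x c * inner ℝ (decode G c) w = inner ℝ x w := by
  have := nonempty_codeSymbol hd
  have hm' : (m : ℝ) ≠ 0 := by positivity
  rw [sum_encodeProb_mul]
  have e : ∀ c : Codeword d m, inner ℝ (decode G c) w =
      ∑ k, w k * (1 / (m : ℝ)) * ∑ i, symbolEntry G k (c i) := fun c => by
    simp [PiLp.inner_apply, decode_apply, mul_assoc]
  simp only [e]
  rw [seqExpect_sum, PiLp.inner_apply]
  refine Finset.sum_congr rfl fun k _ => ?_
  rw [seqExpect_const_mul, seqExpect_sum]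
  simp only [seqExpect_apply (sum_symbolProb hd x) (symbolProb_nonneg hG hx) (symbolEntry G k),
    sum_symbolProb_mul_symbolEntry hG hd]
  simp
  field_simp

/-- The second moment of the decoded vector: `2 ^ p ≥ d` makes the quantization error of all
entries together negligible. -/
lemma sum_encodeProb_mul_norm_decode_sq_le (hG : 0 < G) (hd : 1 ≤ d) (hm : 1 ≤ m) {x : Vec d}
    (hx : ‖x‖ ≤ G) :
    ∑ c : Codeword d m, encodeProb G x c * ‖decode G c‖ ^ 2 ≤
      G ^ 2 * (1 + 5 / 4 * (d / m)) := by
  have := nonempty_codeSymbol hd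
  have hm' : (0 : ℝ) < m := by positivity
  have hd' : (1 : ℝ) ≤ d := by exact_mod_cast hd
  rw [sum_encodeProb_mul]
  have e : ∀ c : Codeword d m, ‖decode G c‖ ^ 2 =
      ∑ k, (1 / (m : ℝ)) ^ 2 * (∑ i, symbolEntry G k (c i)) ^ 2 := fun c => by
    rw [EuclideanSpace.real_norm_sq_eq]
    simp [decode_apply, mul_pow]
  simp only [e]
  rw [seqExpect_sum]
  have h1 : ∀ k : Fin d, seqExpect (fun _ _ => symbolProb G x)
      (fun c : Codeword d m => (1 / (m : ℝ)) ^ 2 * (∑ i, symbolEntry G k (c i)) ^ 2) ≤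
      (1 / (m : ℝ)) ^ 2 * (m * (d * (x k ^ 2 + (G / 2 ^ precision d) ^ 2 / 4)) +
        m ^ 2 * x k ^ 2) := by
    intro k
    rw [seqExpect_const_mul]
    refine mul_le_mul_of_nonneg_left ?_ (by positivity)
    refine (seqExpect_sum_sq_le (sum_symbolProb hd x) (symbolProb_nonneg hG hx) _).trans ?_
    rw [sum_symbolProb_mul_symbolEntry hG hd]
    gcongr
    exact sum_symbolProb_mul_symbolEntry_sq_le hG hd x k
  have h2 := Finset.sum_le_sum fun k (_ : k ∈ Finset.univ) => h1 k
  refine h2.trans ?_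
  have hxsq : ∑ k, x k ^ 2 = ‖x‖ ^ 2 := (EuclideanSpace.real_norm_sq_eq x).symm
  have hxG : ‖x‖ ^ 2 ≤ G ^ 2 := by gcongr
  have e2 : ∑ k : Fin d, (1 / (m : ℝ)) ^ 2 * (m * (d * (x k ^ 2 + (G / 2 ^ precision d) ^ 2 / 4)) +
        m ^ 2 * x k ^ 2) =
      (1 + d / m) * ‖x‖ ^ 2 + d / m * (d * (G / 2 ^ precision d) ^ 2 / 4) := by
    rw [← hxsq, Finset.mul_sum, ← Finset.mul_sum]
    simp only [mul_add, Finset.sum_add_distrib, ← Finset.mul_sum, Finset.sum_const,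
      Finset.card_univ, Fintype.card_fin, nsmul_eq_mul]
    field_simp
    ring
  rw [e2]
  have hp : (d : ℝ) ≤ 2 ^ precision d := by
    exact_mod_cast Nat.le_pow_clog one_lt_two d
  have h3 : d * (G / 2 ^ precision d) ^ 2 ≤ G ^ 2 := by
    rw [div_pow, mul_div_assoc', div_le_iff₀ (by positivity), mul_comm]
    refine mul_le_mul_of_nonneg_left ?_ (sq_nonneg G)
    nlinarith
  have h4 : 0 ≤ (d : ℝ) / m := by positivity
  nlinarith [mul_le_mul_of_nonneg_left h3 h4, mul_le_mul_of_nonneg_left hxG h4]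

lemma card_codeword_le {k : ℕ} (hk : m * symbolBits d ≤ k) :
    Fintype.card (Codeword d m) ≤ 2 ^ k := by
  have h1 : Fintype.card (CodeSymbol d) ≤ 2 ^ symbolBits d := by
    have h3 : Fintype.card (CodeSymbol d) = d * (2 * (2 ^ Nat.clog 2 d * 2)) := by
      simp only [Fintype.card_prod, Fintype.card_fin, Fintype.card_bool]
      rfl
    rw [h3, symbolBits]
    have h2 : d ≤ 2 ^ Nat.clog 2 d := Nat.le_pow_clog one_lt_two d
    calc d * (2 * (2 ^ Nat.clog 2 d * 2)) ≤ 2 ^ Nat.clog 2 d * (2 * (2 ^ Nat.clog 2 d * 2)) := by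
          gcongr
      _ = 2 ^ (2 * Nat.clog 2 d + 2) := by ring
      _ ≤ _ := Nat.pow_le_pow_right (by norm_num) (by omega)
  rw [Fintype.card_fun, Fintype.card_fin]
  calc _ ≤ (2 ^ symbolBits d) ^ m := Nat.pow_le_pow_left h1 m
    _ = 2 ^ (m * symbolBits d) := by rw [← pow_mul, mul_comm]
    _ ≤ 2 ^ k := Nat.pow_le_pow_right (by norm_num) hk

end EncodingMoments

/-! ### The algorithm on one subgraph -/

section Copies

variable {V : Type*} {𝒢 : SimpleGraph V} {T d : ℕ}

open Classical in
/-- The rounds whose active node belongs to `F`. -/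
noncomputable def rounds (F : 𝒢.Subgraph) (I : Fin T → V) : Finset (Fin T) :=
  {t : Fin T | I t ∈ F.verts}

lemma mem_rounds {F : 𝒢.Subgraph} {I : Fin T → V} {t : Fin T} :
    t ∈ rounds F I ↔ I t ∈ F.verts := by simp [rounds]

lemma one_le_diameter (F : 𝒢.Subgraph) : 1 ≤ diameter F := le_max_left _ _

lemma dist_le_diameter [Finite V] {F : 𝒢.Subgraph} (hF : F.Connected) (x y : F.verts) :
    F.coe.dist x y ≤ diameter F := by
  have hc : F.coe.Connected := hF.coe
  have : Nonempty F.verts := hc.nonempty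
  exact (SimpleGraph.dist_le_diam (SimpleGraph.connected_iff_ediam_ne_top.1 hc)).trans
    (le_max_right _ _)

/-- The available and the missing rounds of the copy on `F` form a pattern of delays at most the
diameter. -/
lemma delayPattern [Finite V] {F : 𝒢.Subgraph} (hF : F.Connected) {DQ : ℕ}
    (hDQ : diameter F ≤ DQ) (I : Fin T → V) :
    DelayPattern (rounds F I) (available F DQ I) (missing F DQ I) (diameter F) where
  mem_missing t _ s := by
    simp only [missing, Finset.mem_filter, Finset.mem_univ, true_and, mem_rounds]
    tauto
  mem_available t _ s hs := by
    simp only [available, received, Finset.mem_filter, Finset.mem_univ, true_and] at hs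
    obtain ⟨h1, h2, -⟩ := hs
    exact ⟨mem_rounds.2 h2, h1⟩
  recent t ht s hs := by
    simp only [missing, Finset.mem_filter, Finset.mem_univ, true_and] at hs
    obtain ⟨h1, h2, h3⟩ := hs
    simp only [available, received, Finset.mem_filter, Finset.mem_univ, true_and] at h3
    have hd := dist_le_diameter hF ⟨I s, h2⟩ ⟨I t, mem_rounds.1 ht⟩
    by_contra! h4
    exact h3 ⟨h1, h2, mem_rounds.1 ht, hd.trans hDQ, by omega⟩

lemma direction_eq (F : 𝒢.Subgraph) (DQ : ℕ) (B : ℝ) (I : Fin T → V) (g : Fin T → Vec d)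
    (t : Fin T) : direction F DQ B I g t =
      delayedDirection (available F DQ I) (missing F DQ I) (diameter F) B g t := rfl

lemma scale_eq (F : 𝒢.Subgraph) (DQ : ℕ) (B ν : ℝ) (I : Fin T → V) (g : Fin T → Vec d)
    (t : Fin T) : scale F DQ B ν I g t = meanScale (available F DQ I) (missing F DQ I)
      (priorEnd F B) ν (feedback F DQ B I g) t := rfl

lemma norm_direction_le (F : 𝒢.Subgraph) (DQ : ℕ) (B : ℝ) (I : Fin T → V) (g : Fin T → Vec d)
    (t : Fin T) : ‖direction F DQ B I g t‖ ≤ 1 := norm_ballProj_le _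

lemma abs_feedback_le (F : 𝒢.Subgraph) (DQ : ℕ) (B : ℝ) (I : Fin T → V) (g : Fin T → Vec d)
    (t : Fin T) : |feedback F DQ B I g t| ≤ ‖g t‖ := by
  refine (abs_real_inner_le_norm _ _).trans ?_
  exact mul_le_of_le_one_left (norm_nonneg _) (norm_direction_le F DQ B I g t)

lemma priorEnd_pos (F : 𝒢.Subgraph) {B : ℝ} (hB : 0 < B) : 0 < priorEnd F B := by
  unfold priorEnd; positivity

lemma priorEnd_mul (F : 𝒢.Subgraph) {B : ℝ} (hB : 0 < B) :
    priorEnd F B * (B * (1 + 2 * (diameter F : ℝ))) = 1 / 20 := by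
  unfold priorEnd
  field_simp

lemma lag_mono {γ : Fin T → Finset (Fin T)} {a b : Fin T → ℝ} (ha : ∀ t, 0 ≤ a t)
    (hab : ∀ t, a t ≤ b t) (t : Fin T) :
    lag γ a t ≤ lag γ b t := by
  have h1 : ∑ i ∈ γ t, a i ≤ ∑ i ∈ γ t, b i := Finset.sum_le_sum fun i _ => hab i
  have h2 : 0 ≤ ∑ i ∈ γ t, a i := Finset.sum_nonneg fun i _ => ha i
  have := ha t
  have := hab t
  have : 0 ≤ b t := (ha t).trans (hab t)
  unfold lag
  gcongr

/-- Against the comparator zero, a copy of the algorithm loses at most `ν`. -/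
lemma sum_inner_subPrediction_le [Finite V] {F : 𝒢.Subgraph} (hF : F.Connected) {DQ : ℕ}
    (hDQ : diameter F ≤ DQ) {B ν : ℝ} (hB : 0 < B) (hν : 0 ≤ ν) (I : Fin T → V)
    {g : Fin T → Vec d} (hg : ∀ t, ‖g t‖ ≤ B) :
    ∑ t ∈ rounds F I, inner ℝ (g t) (subPrediction F DQ B ν I g t) ≤ ν := by
  have h := (delayPattern hF hDQ I).sum_mul_meanScale_le_const hB.le
    (fun t _ => (abs_feedback_le F DQ B I g t).trans (hg t)) (priorEnd_pos F hB) hν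
    (priorEnd_mul F hB).le
  refine le_trans (le_of_eq (Finset.sum_congr rfl fun t _ => ?_)) h
  rw [subPrediction, inner_smul_right, ← scale_eq, mul_comm, feedback,
    real_inner_comm (g t) (direction F DQ B I g t)]

/-- The regret of a copy of the algorithm, split into the regret of the scale against `‖u‖` and
`‖u‖` times the regret of the direction against `u / ‖u‖`. -/
lemma sum_inner_subPrediction_sub_le [Finite V] {F : 𝒢.Subgraph} (hF : F.Connected) {DQ : ℕ}
    (hDQ : diameter F ≤ DQ) {B ν : ℝ} (hB : 0 < B) (hν : 0 < ν) (I : Fin T → V)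
    {g : Fin T → Vec d} (hg : ∀ t, ‖g t‖ ≤ B) {u : Vec d} (hu : u ≠ 0) {η₀ M : ℝ}
    (hη₀ : 0 < η₀) (hη₀e : η₀ ≤ priorEnd F B) (hM : 0 ≤ M)
    (hUM : 4 * ‖u‖ * (∫ η in (0 : ℝ)..priorEnd F B, Real.exp (-η ^ 2)) ≤
      ν * η₀ ^ 2 * Real.exp M) :
    ∑ t ∈ rounds F I, inner ℝ (g t) (subPrediction F DQ B ν I g t - u) ≤
      ν + 2 * ‖u‖ / η₀ * (M + η₀ ^ 2 *
        (∑ t ∈ rounds F I, lag (missing F DQ I) (fun s => ‖g s‖) t + 1)) +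
      ‖u‖ * (5 * √(∑ t ∈ rounds F I, lag (missing F DQ I) (fun s => ‖g s‖) t +
        B ^ 2 * (2 * (diameter F : ℝ) + 1) ^ 2)) := by
  have hP := delayPattern hF hDQ I
  have hU : 0 < ‖u‖ := norm_pos_iff.2 hu
  have h1 := hP.sum_mul_meanScale_sub_le hB.le
    (fun t _ => (abs_feedback_le F DQ B I g t).trans (hg t)) (priorEnd_pos F hB) hν
    (priorEnd_mul F hB).le hU hη₀ hη₀e hM hUM
  have hunit : ‖(1 / ‖u‖) • u‖ ≤ 1 := by
    rw [norm_smul, Real.norm_of_nonneg (by positivity), one_div, inv_mul_cancel₀ hU.ne']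
  have h2 := hP.sum_inner_delayedDirection_sub_le hB (fun t _ => hg t) hunit
  have h3 : ∑ t ∈ rounds F I, lag (missing F DQ I) (fun s => |feedback F DQ B I g s|) t ≤
      ∑ t ∈ rounds F I, lag (missing F DQ I) (fun s => ‖g s‖) t :=
    Finset.sum_le_sum fun t _ => lag_mono (fun _ => abs_nonneg _)
      (fun s => abs_feedback_le F DQ B I g s) t
  have h4 : ∀ t, inner ℝ (g t) (subPrediction F DQ B ν I g t - u) =
      feedback F DQ B I g t * (meanScale (available F DQ I) (missing F DQ I)
        (priorEnd F B) ν (feedback F DQ B I g) t - ‖u‖) +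
      ‖u‖ * inner ℝ (g t) (delayedDirection (available F DQ I) (missing F DQ I) (diameter F) B g t
        - (1 / ‖u‖) • u) := by
    intro t
    rw [← direction_eq, ← scale_eq, subPrediction, inner_sub_right, inner_sub_right,
      inner_smul_right, inner_smul_right, feedback,
      real_inner_comm (g t) (direction F DQ B I g t)]
    field_simp
    ring
  rw [Finset.sum_congr rfl fun t _ => h4 t, Finset.sum_add_distrib, ← Finset.mul_sum]
  refine add_le_add (h1.trans ?_) (mul_le_mul_of_nonneg_left h2 hU.le)
  gcongr

/-! ### Causality: a prediction depends only on what happened before -/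

variable {I I' : Fin T → V} {g g' : Fin T → Vec d}

lemma available_congr (F : 𝒢.Subgraph) (DQ : ℕ) {t : Fin T} (hI : ∀ s ≤ t, I s = I' s) :
    available F DQ I t = available F DQ I' t := by
  ext s
  simp only [available, received, Finset.mem_filter, Finset.mem_univ, true_and]
  refine and_congr_right fun hs => ?_
  rw [hI s hs.le, hI t le_rfl]

lemma lt_of_mem_available {F : 𝒢.Subgraph} {DQ : ℕ} {s t : Fin T}
    (h : s ∈ available F DQ I t) : s < t := by
  simp only [available, received, Finset.mem_filter, Finset.mem_univ, true_and] at h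
  exact h.1

lemma missing_congr (F : 𝒢.Subgraph) (DQ : ℕ) {t : Fin T} (hI : ∀ s ≤ t, I s = I' s) :
    missing F DQ I t = missing F DQ I' t := by
  ext s
  simp only [missing, Finset.mem_filter, Finset.mem_univ, true_and, available_congr F DQ hI]
  refine and_congr_right fun hs => ?_
  rw [hI s hs.le]

lemma observedLag_congr (F : 𝒢.Subgraph) (DQ : ℕ) {t : Fin T} (hI : ∀ s ≤ t, I s = I' s)
    {a a' : Fin T → ℝ} (ha : ∀ s < t, a s = a' s) :
    observedLag F DQ I a t = observedLag F DQ I' a' t := by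
  unfold observedLag
  rw [available_congr F DQ hI]
  refine Finset.sum_congr rfl fun s hs => ?_
  have hst := lt_of_mem_available hs
  rw [ha s hst, missing_congr F DQ fun i hi => hI i (hi.trans hst.le)]
  congr 2
  exact Finset.sum_congr rfl fun i hi => ha i (lt_of_mem_available (Finset.mem_inter.1 hi).2)

lemma direction_congr (F : 𝒢.Subgraph) (DQ : ℕ) (B : ℝ) {t : Fin T} (hI : ∀ s ≤ t, I s = I' s)
    (hg : ∀ s < t, g s = g' s) : direction F DQ B I g t = direction F DQ B I' g' t := by
  have h1 : learningRate F DQ B I g t = learningRate F DQ B I' g' t := by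
    unfold learningRate
    rw [observedLag_congr F DQ hI fun s hs => by rw [hg s hs]]
  have h2 : ∑ s ∈ available F DQ I t, g s = ∑ s ∈ available F DQ I' t, g' s := by
    rw [available_congr F DQ hI]
    exact Finset.sum_congr rfl fun s hs => hg s (lt_of_mem_available hs)
  unfold direction
  rw [h1, h2]

lemma feedback_congr (F : 𝒢.Subgraph) (DQ : ℕ) (B : ℝ) {t : Fin T} (hI : ∀ s ≤ t, I s = I' s)
    (hg : ∀ s ≤ t, g s = g' s) : feedback F DQ B I g t = feedback F DQ B I' g' t := by
  unfold feedback
  rw [direction_congr F DQ B hI fun s hs => hg s hs.le, hg t le_rfl]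

lemma scale_congr (F : 𝒢.Subgraph) (DQ : ℕ) (B ν : ℝ) {t : Fin T} (hI : ∀ s ≤ t, I s = I' s)
    (hg : ∀ s < t, g s = g' s) : scale F DQ B ν I g t = scale F DQ B ν I' g' t := by
  have hf : ∀ s < t, feedback F DQ B I g s = feedback F DQ B I' g' s := fun s hs =>
    feedback_congr F DQ B (fun i hi => hI i (hi.trans hs.le)) fun i hi => hg i (hi.trans_lt hs)
  have h1 : ∑ s ∈ available F DQ I t, feedback F DQ B I g s =
      ∑ s ∈ available F DQ I' t, feedback F DQ B I' g' s := by
    rw [available_congr F DQ hI]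
    exact Finset.sum_congr rfl fun s hs => hf s (lt_of_mem_available hs)
  have h2 := observedLag_congr F DQ hI (a := fun s => |feedback F DQ B I g s|)
    (a' := fun s => |feedback F DQ B I' g' s|) fun s hs => by rw [hf s hs]
  unfold scale
  rw [h1, h2]

lemma subPrediction_congr (F : 𝒢.Subgraph) (DQ : ℕ) (B ν : ℝ) {t : Fin T}
    (hI : ∀ s ≤ t, I s = I' s) (hg : ∀ s < t, g s = g' s) :
    subPrediction F DQ B ν I g t = subPrediction F DQ B ν I' g' t := by
  unfold subPrediction
  rw [scale_congr F DQ B ν hI hg, direction_congr F DQ B hI hg]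

end Copies

/-! ### Communication -/

section Messages

variable {V : Type*} {𝒢 : SimpleGraph V} {T : ℕ}

lemma card_forwarded_le (Q : Finset 𝒢.Subgraph) (I : Fin T → V) (n : V) (t : Fin T) :
    (forwarded Q I n t).card ≤ maxDiameter Q := by
  have : (forwarded Q I n t).card ≤ (Finset.Ioc (t : ℕ) (t + maxDiameter Q)).card := by
    refine Finset.card_le_card_of_injOn (fun s => (s : ℕ) + maxDiameter Q) ?_
      (fun x _ y _ h => Fin.ext (Nat.add_right_cancel h))
    intro s hs
    simp only [forwarded, Finset.mem_coe, Finset.mem_filter, Finset.mem_univ, true_and] at hs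
    obtain ⟨-, h1, h2⟩ := hs
    rw [Finset.mem_coe, Finset.mem_Ioc]
    dsimp only
    omega
  refine this.trans ?_
  rw [Nat.card_Ioc]
  omega

lemma card_forwarded_mul_le (Q : Finset 𝒢.Subgraph) (b : ℕ) (I : Fin T → V) (n : V)
    (t : Fin T) : (forwarded Q I n t).card * bitsPerGradient Q b ≤ b :=
  (Nat.mul_le_mul_right _ (card_forwarded_le Q I n t)).trans (Nat.mul_div_le b _)

lemma one_le_repetitions {Q : Finset 𝒢.Subgraph} {b d : ℕ} (hQ : 0 < maxDiameter Q)
    (hb : maxDiameter Q * symbolBits d ≤ b) : 1 ≤ repetitions Q b d := by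
  have hs : 0 < symbolBits d := by unfold symbolBits; omega
  unfold repetitions bitsPerGradient
  rw [Nat.one_le_div_iff hs, Nat.le_div_iff_mul_le hQ, mul_comm]
  exact hb

lemma div_repetitions_le {Q : Finset 𝒢.Subgraph} {b d : ℕ} (hQ : 0 < maxDiameter Q)
    (hb : maxDiameter Q * symbolBits d ≤ b) :
    (d : ℝ) / repetitions Q b d ≤ 2 * ((d : ℝ) * symbolBits d * maxDiameter Q / b) := by
  have hm := one_le_repetitions hQ hb
  have hs : 0 < symbolBits d := by unfold symbolBits; omega
  have hb0 : 0 < b := lt_of_lt_of_le (Nat.mul_pos hQ hs) hb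
  have h1 : b < maxDiameter Q * symbolBits d * (repetitions Q b d + 1) := by
    unfold repetitions bitsPerGradient
    rw [Nat.div_div_eq_div_mul]
    exact Nat.lt_mul_div_succ b (Nat.mul_pos hQ hs)
  have h2 : b ≤ 2 * (maxDiameter Q * symbolBits d * repetitions Q b d) := by nlinarith
  have h3 : (b : ℝ) ≤ 2 * (maxDiameter Q * symbolBits d * repetitions Q b d) := by
    exact_mod_cast h2
  have hm' : (0 : ℝ) < repetitions Q b d := by exact_mod_cast hm
  have hb' : (0 : ℝ) < b := by exact_mod_cast hb0
  rw [div_le_iff₀ hm', ← mul_div_assoc, div_mul_eq_mul_div, le_div_iff₀ hb']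
  nlinarith [mul_le_mul_of_nonneg_left h3 (Nat.cast_nonneg (α := ℝ) d)]

end Messages

/-! ### The game: from losses to decoded gradients -/

lemma IsAdaptedLaw.seqExpect_sqrt_le {T : ℕ} {Ω : Type*} [Fintype Ω] [Nonempty Ω]
    {κ : Fin T → (Fin T → Ω) → Ω → ℝ} (hκ : IsAdaptedLaw κ) {f : (Fin T → Ω) → ℝ} {W : ℝ}
    (hf : ∀ h, 0 ≤ f h) (hW : 0 < W) (hfW : seqExpect κ f ≤ W) :
    seqExpect κ (fun h => √(f h)) ≤ √W := by
  have hs : 0 < √W := Real.sqrt_pos.2 hW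
  have h1 : ∀ h, √(f h) ≤ 1 / (2 * √W) * f h + √W / 2 := fun h => by
    have h2 := Real.sq_sqrt (hf h)
    have h3 : 1 / (2 * √W) * f h + √W / 2 - √(f h) = (√(f h) - √W) ^ 2 / (2 * √W) := by
      rw [← h2, Real.sqrt_sq (Real.sqrt_nonneg _)]
      field_simp
      ring
    have h4 : 0 ≤ (√(f h) - √W) ^ 2 / (2 * √W) := by positivity
    linarith
  refine (hκ.seqExpect_mono h1).trans ?_
  rw [seqExpect_add, seqExpect_const_mul, hκ.seqExpect_const]
  have h5 : 1 / (2 * √W) * seqExpect κ f ≤ 1 / (2 * √W) * W :=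
    mul_le_mul_of_nonneg_left hfW (by positivity)
  have h6 : 1 / (2 * √W) * W = √W / 2 := by
    nth_rewrite 2 [← Real.mul_self_sqrt hW.le]
    field_simp
  linarith

namespace Adversary

variable {V : Type*} {𝒢 : SimpleGraph V} {T d m : ℕ} {A : Adversary V d m T}
  {Q : Finset 𝒢.Subgraph} {G : ℝ}

/-- The law of the codeword of each round, given the codewords of the earlier rounds. -/
noncomputable def law (A : Adversary V d m T) (G : ℝ) :
    Fin T → (Fin T → Codeword d m) → Codeword d m → ℝ :=
  fun t h c => encodeProb G (A.grad h t) c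

lemma expect_eq_seqExpect (A : Adversary V d m T) (G : ℝ) (f : (Fin T → Codeword d m) → ℝ) :
    A.expect G f = seqExpect (A.law G) f := rfl

lemma Valid.isAdaptedLaw (hA : A.Valid Q G) (hG : 0 < G) (hd : 1 ≤ d) :
    IsAdaptedLaw (A.law G) where
  adapted t h h' e := by
    unfold law
    rw [(hA.adapted h h' t fun s hs => e s hs).2.2]
  sum_eq_one t h := sum_encodeProb hG hd (hA.bounded h t)
  nonneg t h c := encodeProb_nonneg hG (hA.bounded h t) c

lemma Valid.agent_eq (hA : A.Valid Q G) {t : Fin T} {h h' : Fin T → Codeword d m}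
    (e : ∀ s : Fin T, (s : ℕ) < t → h s = h' s) : ∀ s ≤ t, A.agent h s = A.agent h' s :=
  fun s hs => (hA.adapted h h' s fun i hi => e i (lt_of_lt_of_le hi hs)).1

/-- A decoded gradient may be replaced by the gradient in expected inner products with vectors that
are determined before the round. -/
lemma Valid.expect_inner_decode (hA : A.Valid Q G) (hG : 0 < G) (hd : 1 ≤ d) (hm : 1 ≤ m)
    (t : Fin T) {Y : (Fin T → Codeword d m) → Vec d} (hY : DependsBefore Y t) :
    A.expect G (fun h => inner ℝ (decode G (h t)) (Y h)) =
      A.expect G (fun h => inner ℝ (A.grad h t) (Y h)) := by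
  have := nonempty_codeSymbol hd
  have hκ := hA.isAdaptedLaw hG hd
  rw [expect_eq_seqExpect, hκ.seqExpect_tower t, expect_eq_seqExpect]
  · congr 1
    ext h
    rw [← sum_encodeProb_mul_inner_decode hG hd hm (hA.bounded h t) (Y h)]
    refine Finset.sum_congr rfl fun c _ => ?_
    rw [Function.update_self, hY (Function.update h t c) h]
    · rfl
    · intro s hs
      rw [Function.update_of_ne]
      rintro rfl
      omega
  · intro h h' e
    beta_reduce
    rw [e t (by omega), hY h h' fun s hs => e s (by omega)]

lemma Valid.expect_mul_norm_decode_sq_le (hA : A.Valid Q G) (hG : 0 < G) (hd : 1 ≤ d)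
    (hm : 1 ≤ m) (t : Fin T) {ρ : (Fin T → Codeword d m) → ℝ} (hρ : DependsBefore ρ t)
    (hρ0 : ∀ h, 0 ≤ ρ h) :
    A.expect G (fun h => ρ h * ‖decode G (h t)‖ ^ 2) ≤
      G ^ 2 * (1 + 5 / 4 * (d / m)) * A.expect G ρ := by
  have := nonempty_codeSymbol hd
  have hκ := hA.isAdaptedLaw hG hd
  rw [expect_eq_seqExpect, hκ.seqExpect_tower t, expect_eq_seqExpect, ← seqExpect_const_mul]
  · refine hκ.seqExpect_mono fun h => ?_
    have h1 : ∀ c, A.law G t h c * (ρ (Function.update h t c) *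
        ‖decode G (Function.update h t c t)‖ ^ 2) =
        ρ h * (encodeProb G (A.grad h t) c * ‖decode G c‖ ^ 2) := fun c => by
      rw [Function.update_self, hρ (Function.update h t c) h]
      · unfold law
        ring
      · intro s hs
        rw [Function.update_of_ne]
        rintro rfl
        omega
    simp only [h1]
    rw [← Finset.mul_sum, mul_comm]
    exact mul_le_mul_of_nonneg_right
      (sum_encodeProb_mul_norm_decode_sq_le hG hd hm (hA.bounded h t)) (hρ0 h)
  · intro h h' e
    beta_reduce
    rw [e t (by omega), hρ h h' fun s hs => e s (by omega)]

/-- The prediction of the copy of the algorithm on `F`. -/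
noncomputable def copyPlay (A : Adversary V d m T) (Q : Finset 𝒢.Subgraph) (G : ℝ)
    (F : 𝒢.Subgraph) (h : Fin T → Codeword d m) (t : Fin T) : Vec d :=
  subPrediction F (maxDiameter Q) (2 * (d : ℝ) * G) (1 / (Q.card : ℝ)) (A.agent h)
    (fun s => decode G (h s)) t

lemma Valid.dependsBefore_copyPlay (hA : A.Valid Q G) (F : 𝒢.Subgraph) (t : Fin T) :
    DependsBefore (fun h => A.copyPlay Q G F h t) t := fun h h' e =>
  subPrediction_congr F _ _ _ (hA.agent_eq e) fun s hs => by rw [e s hs]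

/-- The regret on `F` of the copy of the algorithm on `F`, with the losses linearized by the
vectors `x`. -/
noncomputable def linearRegret (A : Adversary V d m T) (Q : Finset 𝒢.Subgraph) (G : ℝ)
    (F : 𝒢.Subgraph) (u : Vec d) (x : (Fin T → Codeword d m) → Fin T → Vec d)
    (h : Fin T → Codeword d m) : ℝ :=
  ∑ t ∈ rounds F (A.agent h), inner ℝ (x h t) (A.copyPlay Q G F h t - u)

lemma sum_rounds_eq (F : 𝒢.Subgraph) (I : Fin T → V) (f : Fin T → ℝ) :
    ∑ t ∈ rounds F I, f t = ∑ t, (rounds F I : Set (Fin T)).indicator f t := by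
  classical
  simp only [Set.indicator_apply, Finset.mem_coe]
  rw [Finset.sum_ite_mem, Finset.univ_inter]

lemma Valid.mem_rounds_iff (hA : A.Valid Q G) (F : 𝒢.Subgraph) {t : Fin T}
    {h h' : Fin T → Codeword d m} (e : ∀ s : Fin T, (s : ℕ) < t → h s = h' s) :
    t ∈ rounds F (A.agent h) ↔ t ∈ rounds F (A.agent h') := by
  rw [mem_rounds, mem_rounds, hA.agent_eq e t le_rfl]

lemma Valid.expect_linearRegret_grad (hA : A.Valid Q G) (hG : 0 < G) (hd : 1 ≤ d) (hm : 1 ≤ m)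
    (F : 𝒢.Subgraph) (u : Vec d) :
    A.expect G (A.linearRegret Q G F u A.grad) =
      A.expect G (A.linearRegret Q G F u fun h t => decode G (h t)) := by
  classical
  have key : ∀ x : (Fin T → Codeword d m) → Fin T → Vec d, A.linearRegret Q G F u x = fun h =>
      ∑ t, inner ℝ (x h t)
        (if t ∈ rounds F (A.agent h) then A.copyPlay Q G F h t - u else 0) := by
    intro x
    ext h
    rw [linearRegret, sum_rounds_eq]
    refine Finset.sum_congr rfl fun t _ => ?_
    by_cases ht : t ∈ rounds F (A.agent h) <;> simp [ht]
  rw [key, key, expect_eq_seqExpect, expect_eq_seqExpect, seqExpect_sum, seqExpect_sum]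
  refine Finset.sum_congr rfl fun t _ => ?_
  refine (hA.expect_inner_decode hG hd hm t fun h h' e => ?_).symm
  have h1 := hA.dependsBefore_copyPlay F t h h' e
  have h2 := hA.mem_rounds_iff F e
  simp only at h1
  simp only [h2, h1]

lemma Valid.expect_sum_norm_decode_sq_le (hA : A.Valid Q G) (hG : 0 < G) (hd : 1 ≤ d)
    (hm : 1 ≤ m) (F : 𝒢.Subgraph) :
    A.expect G (fun h => ∑ t ∈ rounds F (A.agent h), ‖decode G (h t)‖ ^ 2) ≤
      G ^ 2 * (1 + 5 / 4 * (d / m)) * A.expect G (A.cellRounds F) := by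
  classical
  have e1 : (fun h : Fin T → Codeword d m => ∑ t ∈ rounds F (A.agent h), ‖decode G (h t)‖ ^ 2) =
      fun h => ∑ t, (if t ∈ rounds F (A.agent h) then 1 else 0) * ‖decode G (h t)‖ ^ 2 := by
    ext h
    rw [sum_rounds_eq]
    refine Finset.sum_congr rfl fun t _ => ?_
    by_cases ht : t ∈ rounds F (A.agent h) <;> simp [ht]
  have e2 : A.cellRounds F = fun h => ∑ t, if t ∈ rounds F (A.agent h) then (1 : ℝ) else 0 := by
    ext h
    simp only [Finset.sum_ite_mem, Finset.univ_inter, Finset.sum_const, nsmul_eq_mul, mul_one]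
    rfl
  rw [e1, e2, expect_eq_seqExpect, expect_eq_seqExpect, seqExpect_sum, seqExpect_sum,
    Finset.mul_sum]
  refine Finset.sum_le_sum fun t _ => ?_
  refine hA.expect_mul_norm_decode_sq_le hG hd hm t (fun h h' e => ?_) fun h => ?_
  · have h2 := hA.mem_rounds_iff F e
    simp only [h2]
  · split_ifs <;> norm_num

lemma Valid.expect_cellRounds_nonneg (hA : A.Valid Q G) (hG : 0 < G) (hd : 1 ≤ d)
    (F : 𝒢.Subgraph) : 0 ≤ A.expect G (A.cellRounds F) := by
  have := nonempty_codeSymbol hd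
  have hκ := hA.isAdaptedLaw hG hd
  rw [← hκ.seqExpect_const 0]
  exact hκ.seqExpect_mono fun h => Nat.cast_nonneg _

lemma norm_decode_le_two_mul (hG : 0 < G) (c : Codeword d m) :
    ‖decode G c‖ ≤ 2 * (d : ℝ) * G := by
  have h1 := norm_decode_le hG c
  have h2 : 0 ≤ (d : ℝ) * G := by positivity
  linarith

lemma diameter_le_maxDiameter {F : 𝒢.Subgraph} (hF : F ∈ Q) : diameter F ≤ maxDiameter Q :=
  Finset.le_sup (f := diameter) hF

lemma Valid.expect_linearRegret_zero_le [Finite V] (hA : A.Valid Q G) (hG : 0 < G) (hd : 1 ≤ d)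
    (hm : 1 ≤ m) {F : 𝒢.Subgraph} (hFQ : F ∈ Q) (hF : F.Connected) :
    A.expect G (A.linearRegret Q G F 0 A.grad) ≤ 1 / (Q.card : ℝ) := by
  have := nonempty_codeSymbol hd
  have hκ := hA.isAdaptedLaw hG hd
  rw [hA.expect_linearRegret_grad hG hd hm, expect_eq_seqExpect,
    ← hκ.seqExpect_const (1 / (Q.card : ℝ))]
  refine hκ.seqExpect_mono fun h => ?_
  have hB : 0 < 2 * (d : ℝ) * G := by positivity
  have := sum_inner_subPrediction_le hF (diameter_le_maxDiameter hFQ) hB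
    (by positivity : 0 ≤ 1 / (Q.card : ℝ)) (A.agent h) (g := fun s => decode G (h s))
    (fun t => norm_decode_le_two_mul hG (h t))
  simp only [linearRegret, sub_zero]
  exact this

/-- The trivial bound, by the loss of the zero comparator and the norms of the gradients. -/
lemma Valid.expect_linearRegret_le_trivial [Finite V] (hA : A.Valid Q G) (hG : 0 < G)
    (hd : 1 ≤ d) (hm : 1 ≤ m) {F : 𝒢.Subgraph} (hFQ : F ∈ Q) (hF : F.Connected) (u : Vec d) :
    A.expect G (A.linearRegret Q G F u A.grad) ≤
      1 / (Q.card : ℝ) + ‖u‖ * G * A.expect G (A.cellRounds F) := by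
  have hκ := hA.isAdaptedLaw hG hd
  refine le_trans ?_ (add_le_add_left (hA.expect_linearRegret_zero_le hG hd hm hFQ hF) _)
  rw [expect_eq_seqExpect, expect_eq_seqExpect, expect_eq_seqExpect, ← seqExpect_const_mul,
    ← seqExpect_add]
  refine hκ.seqExpect_mono fun h => ?_
  have h1 : ∀ t ∈ rounds F (A.agent h), inner ℝ (A.grad h t) (A.copyPlay Q G F h t - u) ≤
      inner ℝ (A.grad h t) (A.copyPlay Q G F h t - 0) + ‖u‖ * G := by
    intro t _
    rw [sub_zero, inner_sub_right]
    have h2 := (abs_le.1 (abs_real_inner_le_norm (A.grad h t) u)).1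
    have h3 := mul_le_mul_of_nonneg_right (hA.bounded h t) (norm_nonneg u)
    linarith
  refine (Finset.sum_le_sum h1).trans (le_of_eq ?_)
  rw [Finset.sum_add_distrib, Finset.sum_const, nsmul_eq_mul,
    mul_comm (((rounds F _).card : ℕ) : ℝ)]
  rfl

/-- The expected regret of a copy for a fixed learning rate `η₀` and level `M` of the scale, in
terms of a bound `W` on the expected lag. -/
lemma Valid.expect_linearRegret_le [Finite V] (hA : A.Valid Q G) (hG : 0 < G)
    (hd : 1 ≤ d) (hm : 1 ≤ m) {F : 𝒢.Subgraph} (hFQ : F ∈ Q) (hF : F.Connected) {u : Vec d}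
    (hu : u ≠ 0) {η₀ M W : ℝ} (hη₀ : 0 < η₀) (hη₀e : η₀ ≤ priorEnd F (2 * (d : ℝ) * G))
    (hM : 0 ≤ M) (hUM : 4 * ‖u‖ * (∫ η in (0 : ℝ)..priorEnd F (2 * (d : ℝ) * G),
      Real.exp (-η ^ 2)) ≤ 1 / (Q.card : ℝ) * η₀ ^ 2 * Real.exp M)
    (hW : (1 + 2 * (diameter F : ℝ)) *
      (G ^ 2 * (1 + 5 / 4 * (d / m)) * A.expect G (A.cellRounds F)) ≤ W) :
    A.expect G (A.linearRegret Q G F u A.grad) ≤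
      1 / (Q.card : ℝ) + 2 * ‖u‖ / η₀ * (M + η₀ ^ 2 * (W + 1)) +
        ‖u‖ * (5 * √(W + (2 * (d : ℝ) * G) ^ 2 * (2 * (diameter F : ℝ) + 1) ^ 2)) := by
  have := nonempty_codeSymbol hd
  have hκ := hA.isAdaptedLaw hG hd
  have hB : 0 < 2 * (d : ℝ) * G := by positivity
  have hQ : 0 < (Q.card : ℝ) := by exact_mod_cast Finset.card_pos.2 ⟨F, hFQ⟩
  set c := (2 * (d : ℝ) * G) ^ 2 * (2 * (diameter F : ℝ) + 1) ^ 2 with hc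
  have hc0 : 0 < c := by positivity
  set Λ : (Fin T → Codeword d m) → ℝ := fun h => ∑ t ∈ rounds F (A.agent h),
    lag (missing F (maxDiameter Q) (A.agent h)) (fun s => ‖decode G (h s)‖) t with hΛ
  have hΛ0 : ∀ h, 0 ≤ Λ h := fun h => Finset.sum_nonneg fun t ht =>
    (delayPattern hF (diameter_le_maxDiameter hFQ) (A.agent h)).lag_nonneg
      (fun _ _ => norm_nonneg _) ht
  have hEΛ : seqExpect (A.law G) Λ ≤ W := by
    refine le_trans ?_ hW
    refine (hκ.seqExpect_mono fun h =>
      (delayPattern hF (diameter_le_maxDiameter hFQ) (A.agent h)).sum_lag_le).trans ?_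
    rw [seqExpect_const_mul]
    exact mul_le_mul_of_nonneg_left (hA.expect_sum_norm_decode_sq_le hG hd hm F) (by positivity)
  have hW0 : 0 ≤ W := by
    refine le_trans ?_ hEΛ
    rw [← hκ.seqExpect_const 0]
    exact hκ.seqExpect_mono hΛ0
  rw [hA.expect_linearRegret_grad hG hd hm, expect_eq_seqExpect]
  have hpath : ∀ h, A.linearRegret Q G F u (fun h t => decode G (h t)) h ≤
      (1 / (Q.card : ℝ) + 2 * ‖u‖ / η₀ * (M + η₀ ^ 2)) + (2 * ‖u‖ / η₀ * η₀ ^ 2) * Λ h +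
        (‖u‖ * 5) * √(Λ h + c) := fun h => by
    have h1 := sum_inner_subPrediction_sub_le hF (diameter_le_maxDiameter hFQ) hB
      (by positivity : 0 < 1 / (Q.card : ℝ)) (A.agent h) (g := fun s => decode G (h s))
      (fun t => norm_decode_le_two_mul hG (h t)) hu hη₀ hη₀e hM hUM
    refine h1.trans (le_of_eq ?_)
    simp only [hΛ, hc]
    ring
  refine (hκ.seqExpect_mono hpath).trans ?_
  rw [seqExpect_add, seqExpect_add, hκ.seqExpect_const, seqExpect_const_mul, seqExpect_const_mul]
  have h1 := hκ.seqExpect_sqrt_le (f := fun h => Λ h + c) (W := W + c)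
    (fun h => by linarith [hΛ0 h]) (by linarith) (by
      rw [seqExpect_add, hκ.seqExpect_const]; linarith)
  have h2 := mul_le_mul_of_nonneg_left hEΛ (by positivity : 0 ≤ 2 * ‖u‖ / η₀ * η₀ ^ 2)
  have h3 := mul_le_mul_of_nonneg_left h1 (by positivity : 0 ≤ ‖u‖ * 5)
  linarith

/-- Convexity and iterate addition: the regret over a partition is at most the sum of the
linearized regrets of all copies, with comparator zero for the copies outside the partition. -/
lemma Valid.expect_sum_cellRegret_le (hA : A.Valid Q G) (hG : 0 < G) (hd : 1 ≤ d) {r : ℕ}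
    {F : Fin r → 𝒢.Subgraph} (hF : A.IsPartition Q F) (hinj : Function.Injective F)
    (u : Fin r → Vec d) [DecidableEq 𝒢.Subgraph] :
    A.expect G (fun h => ∑ j, A.cellRegret Q G (F j) (u j) h) ≤
      ∑ j, A.expect G (A.linearRegret Q G (F j) (u j) A.grad) +
        ∑ F' ∈ Q \ Finset.univ.image F, A.expect G (A.linearRegret Q G F' 0 A.grad) := by
  have hκ := hA.isAdaptedLaw hG hd
  simp only [expect_eq_seqExpect]
  rw [← seqExpect_sum, ← seqExpect_sum, ← seqExpect_add]
  refine hκ.seqExpect_mono fun h => ?_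
  set w := A.play Q G h with hw
  set g := A.grad h with hg
  have h1 : ∀ j, A.cellRegret Q G (F j) (u j) h ≤
      ∑ t ∈ rounds (F j) (A.agent h), inner ℝ (g t) (w t) -
        ∑ t ∈ rounds (F j) (A.agent h), inner ℝ (g t) (u j) := fun j => by
    rw [← Finset.sum_sub_distrib]
    refine Finset.sum_le_sum fun t _ => ?_
    have h2 := hA.subgradient h t (u j)
    rw [inner_sub_right] at h2
    linarith
  have h3 : ∑ j, ∑ t ∈ rounds (F j) (A.agent h), inner ℝ (g t) (w t) =
      ∑ t, inner ℝ (g t) (w t) := by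
    simp only [sum_rounds_eq]
    rw [Finset.sum_comm]
    refine Finset.sum_congr rfl fun t _ => ?_
    obtain ⟨j, hj⟩ := hF.cover h t
    rw [Finset.sum_eq_single j]
    · exact Set.indicator_of_mem (Finset.mem_coe.2 (mem_rounds.2 hj)) _
    · intro i _ hij
      refine Set.indicator_of_notMem (fun hi => ?_) _
      exact Set.disjoint_left.1 (hF.disjoint i j hij) (mem_rounds.1 (Finset.mem_coe.1 hi)) hj
    · simp
  have h4 : ∑ t, inner ℝ (g t) (w t) = ∑ F' ∈ Q, A.linearRegret Q G F' 0 A.grad h := by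
    simp only [linearRegret, sub_zero, sum_rounds_eq]
    rw [Finset.sum_comm]
    refine Finset.sum_congr rfl fun t _ => ?_
    rw [hw, play, prediction, inner_sum]
    refine Finset.sum_congr rfl fun F' _ => ?_
    by_cases ht : A.agent h t ∈ F'.verts
    · rw [if_pos ht, Set.indicator_of_mem (Finset.mem_coe.2 (mem_rounds.2 ht))]
      rfl
    · rw [if_neg ht, Set.indicator_of_notMem (fun h => ht (mem_rounds.1 (Finset.mem_coe.1 h))),
        inner_zero_right]
  have h5 : ∑ F' ∈ Q, A.linearRegret Q G F' 0 A.grad h =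
      ∑ F' ∈ Q \ Finset.univ.image F, A.linearRegret Q G F' 0 A.grad h +
        ∑ j, A.linearRegret Q G (F j) 0 A.grad h := by
    rw [← Finset.sum_sdiff (Finset.image_subset_iff.2 fun j _ => hF.mem j :
      Finset.univ.image F ⊆ Q), Finset.sum_image fun i _ j _ hij => hinj hij]
  have h6 : ∀ j, A.linearRegret Q G (F j) 0 A.grad h -
      ∑ t ∈ rounds (F j) (A.agent h), inner ℝ (g t) (u j) =
      A.linearRegret Q G (F j) (u j) A.grad h := fun j => by
    rw [linearRegret, linearRegret, ← Finset.sum_sub_distrib]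
    refine Finset.sum_congr rfl fun t _ => ?_
    rw [sub_zero, inner_sub_right]
  calc _ ≤ ∑ j, (∑ t ∈ rounds (F j) (A.agent h), inner ℝ (g t) (w t) -
        ∑ t ∈ rounds (F j) (A.agent h), inner ℝ (g t) (u j)) :=
        Finset.sum_le_sum fun j _ => h1 j
    _ = _ := by
        simp only [← h6]
        rw [Finset.sum_sub_distrib, Finset.sum_sub_distrib, h3, h4, h5]
        ring

end Adversary

/-! ### The choice of the learning rate and the final bounds -/

lemma sqrt_add_le_sqrt_add_sqrt {x y : ℝ} (hx : 0 ≤ x) (hy : 0 ≤ y) : √(x + y) ≤ √x + √y := by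
  rw [Real.sqrt_le_left (by positivity), add_sq, Real.sq_sqrt hx, Real.sq_sqrt hy]
  have : 0 ≤ 2 * √x * √y := by positivity
  linarith

/-- A learning rate that balances the logarithmic factor `L` and the order `lam = G² κ D τ` of the
expected lag, in the regime in which the trivial bound is not good enough. -/
lemma regret_le_of_balanced_rate {R N D d G U τ κ L a Z : ℝ} (hN : 1 ≤ N) (hD : 1 ≤ D) (hd : 1 ≤ d)
    (hG : 0 < G) (hU0 : 0 < U) (hτ : 0 ≤ τ) (hκ : 1 ≤ κ) (hκd : κ ≤ 1 + d)
    (hexp : Real.exp L = 1 + N * D * U * τ * G) (hL1 : 1 ≤ L)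
    (ha : a = 1 / (2 * d * G * 20 * (1 + 2 * D)))
    (hZ0 : 0 ≤ Z) (hZa : Z ≤ a) (hZ1 : Z ≤ 1) (hτ1 : d * D < τ) (hτ2 : 1 < G * τ)
    (hrate : ∀ η₀ M : ℝ, 0 < η₀ → η₀ ≤ a → 0 ≤ M →
      4 * U * Z ≤ 1 / N * η₀ ^ 2 * Real.exp M →
      R ≤ 1 / N + 2 * U / η₀ * (M + η₀ ^ 2 * (8 * (G ^ 2 * κ * D * τ) + 1)) +
        U * (5 * √(8 * (G ^ 2 * κ * D * τ) + (2 * d * G) ^ 2 * (2 * D + 1) ^ 2))) :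
    R ≤ 2000 * (1 / N + (U * G * √(κ * D * τ * L) + U * (√L + d * G * D * L))) := by
  have hN0 : 0 < 1 / N := by positivity
  have p1 : 0 ≤ U * G * √(κ * D * τ * L) := by positivity
  have p2 : 0 ≤ U * √L := by positivity
  have p3 : 0 ≤ U * (d * G * D * L) := by positivity
  set lam := G ^ 2 * κ * D * τ with hlam
  have hlam0 : 0 ≤ lam := by positivity
  have ha0 : 0 < a := by rw [ha]; positivity
  have hinv : 1 / a ≤ 120 * (d * G * D) := by
    rw [ha, one_div_one_div]
    have : 0 < d * G := by positivity
    nlinarith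
  have hUN : 0 < U * N := by positivity
  have hgrow : U * N * (G * τ) ≤ Real.exp L := by
    rw [hexp]
    have : 0 ≤ U * N * (G * τ) := by positivity
    nlinarith
  -- the level `8 L` leaves room for the factor `4` of the scale times the `120` from `1 / a`
  have hgrow' : 480 * Real.exp L ≤ Real.exp (8 * L) := by
    have h1 : Real.exp (8 * L) = Real.exp L * Real.exp (7 * L) := by
      rw [← Real.exp_add]; congr 1; ring
    have h2 : (480 : ℝ) ≤ Real.exp (7 * L) := by
      have h3 : Real.exp 7 ≤ Real.exp (7 * L) := Real.exp_le_exp.2 (by linarith)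
      have h4 : Real.exp 7 = Real.exp 1 ^ 7 := by rw [← Real.exp_nat_mul]; norm_num
      have h5 : (2.7 : ℝ) ^ 7 ≤ Real.exp 1 ^ 7 := by
        have := Real.exp_one_gt_d9
        gcongr
        linarith
      have h6 : (480 : ℝ) ≤ 2.7 ^ 7 := by norm_num
      linarith
    rw [h1, mul_comm]
    exact mul_le_mul_of_nonneg_left h2 (Real.exp_nonneg _)
  -- `s` is the learning rate that balances the logarithm and the lag
  set s := √(L / (lam + 1)) with hs
  have hs0 : 0 < s := Real.sqrt_pos.2 (by positivity)
  have hs2 : s ^ 2 = L / (lam + 1) := Real.sq_sqrt (by positivity)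
  have hsL : (lam + 1) * s ≤ √(lam * L) + √L := by
    have e : (lam + 1) * s = √((lam + 1) * L) := by
      rw [hs, eq_comm, Real.sqrt_eq_iff_mul_self_eq (by positivity) (by positivity)]
      rw [mul_mul_mul_comm, Real.mul_self_sqrt (by positivity)]
      field_simp
    rw [e, add_mul, one_mul]
    exact sqrt_add_le_sqrt_add_sqrt (by positivity) (by positivity)
  have hLs : L / s = (lam + 1) * s := by
    rw [div_eq_iff hs0.ne', mul_assoc, ← sq, hs2]
    field_simp
  obtain ⟨η₀, hη⟩ : ∃ η₀, η₀ = min a s := ⟨_, rfl⟩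
  have hη0 : 0 < η₀ := by rw [hη]; exact lt_min ha0 hs0
  have hηa : η₀ ≤ a := by rw [hη]; exact min_le_left _ _
  have hηs : η₀ ≤ s := by rw [hη]; exact min_le_right _ _
  have hcond : 4 * U * Z ≤ 1 / N * η₀ ^ 2 * Real.exp (8 * L) := by
    rw [one_div_mul_eq_div, div_mul_eq_mul_div, le_div_iff₀ (by linarith)]
    rcases le_total a s with h | h
    · rw [hη, min_eq_left h]
      have h1 : U * N ≤ a * (120 * Real.exp L) := by
        have h2 : 1 / a ≤ 120 * (G * τ) := by
          refine hinv.trans ?_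
          have : G * (d * D) ≤ G * τ := by gcongr
          linarith
        have h3 : U * N * (1 / a) ≤ 120 * Real.exp L := by
          calc U * N * (1 / a) ≤ U * N * (120 * (G * τ)) := by gcongr
            _ ≤ _ := by linarith
        rw [mul_one_div, div_le_iff₀ ha0] at h3
        linarith
      calc 4 * U * Z * N = 4 * (U * N) * Z := by ring
        _ ≤ 4 * (a * (120 * Real.exp L)) * a := by gcongr
        _ = a ^ 2 * (480 * Real.exp L) := by ring
        _ ≤ _ := by gcongr
    · rw [hη, min_eq_right h, hs2]
      have h1 : Z * (lam + 1) ≤ 2 * (G * τ) := by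
        have h2 : a * lam ≤ G * τ := by
          have h3 : lam ≤ G ^ 2 * (1 + d) * D * τ := by
            rw [hlam]; gcongr
          have h4 : (1 + d) * D ≤ 2 * d * 20 * (1 + 2 * D) := by nlinarith
          rw [ha, one_div_mul_eq_div, div_le_iff₀ (by positivity)]
          refine h3.trans ?_
          have h5 := mul_le_mul_of_nonneg_left h4 (by positivity : 0 ≤ G ^ 2 * τ)
          linarith
        have h3 : Z * lam ≤ a * lam := by gcongr
        linarith
      have h2 : 4 * U * Z * N * (lam + 1) ≤ L * Real.exp (8 * L) := by
        calc 4 * U * Z * N * (lam + 1) = 4 * (U * N) * (Z * (lam + 1)) := by ring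
          _ ≤ 4 * (U * N) * (2 * (G * τ)) := by gcongr
          _ = 8 * (U * N * (G * τ)) := by ring
          _ ≤ 8 * Real.exp L := by gcongr
          _ ≤ 1 * Real.exp (8 * L) := by linarith [Real.exp_pos L]
          _ ≤ _ := by gcongr
      rw [div_mul_eq_mul_div, le_div_iff₀ (by positivity)]
      exact h2
  have hR := hrate η₀ (8 * L) hη0 hηa (by positivity) hcond
  have hinvη : L / η₀ ≤ 120 * (d * G * D) * L + (√(lam * L) + √L) := by
    rcases le_total a s with h | h
    · rw [hη, min_eq_left h]
      have h1 : L / a ≤ 120 * (d * G * D) * L := by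
        rw [div_eq_mul_one_div, mul_comm]
        gcongr
      have : 0 ≤ √(lam * L) + √L := by positivity
      linarith
    · rw [hη, min_eq_right h, hLs]
      have : 0 ≤ 120 * (d * G * D) * L := by positivity
      linarith
  have hlin : η₀ * (8 * lam + 1) ≤ 8 * (√(lam * L) + √L) := by
    calc η₀ * (8 * lam + 1) ≤ s * (8 * (lam + 1)) := by gcongr; linarith
      _ = 8 * ((lam + 1) * s) := by ring
      _ ≤ _ := by gcongr
  have hsqrt : √(8 * lam + (2 * d * G) ^ 2 * (2 * D + 1) ^ 2) ≤
      3 * √(lam * L) + 6 * (d * G * D * L) := by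
    refine (sqrt_add_le_sqrt_add_sqrt (by positivity) (by positivity)).trans (add_le_add ?_ ?_)
    · rw [Real.sqrt_le_left (by positivity), mul_pow, Real.sq_sqrt (by positivity)]
      have : lam * 1 ≤ lam * L := by gcongr
      linarith
    · rw [← mul_pow, Real.sqrt_sq (by positivity)]
      have h1 : 0 < d * G := by positivity
      have h2 : d * G * D * 1 ≤ d * G * D * L := by gcongr
      have h3 : d * G * 1 ≤ d * G * D := by gcongr
      linarith only [h2, h3]
  have hlead : √(lam * L) = G * √(κ * D * τ * L) := by
    rw [show lam * L = G ^ 2 * (κ * D * τ * L) by rw [hlam]; ring,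
      Real.sqrt_mul (by positivity), Real.sqrt_sq hG.le]
  have e1 : 2 * U / η₀ * (8 * L + η₀ ^ 2 * (8 * lam + 1)) =
      2 * U * (8 * (L / η₀) + η₀ * (8 * lam + 1)) := by
    field_simp
  rw [e1] at hR
  have h1 : 2 * U * (8 * (L / η₀) + η₀ * (8 * lam + 1)) ≤
      2 * U * (8 * (120 * (d * G * D) * L + (√(lam * L) + √L)) + 8 * (√(lam * L) + √L)) := by
    gcongr
  have h2 : U * (5 * √(8 * lam + (2 * d * G) ^ 2 * (2 * D + 1) ^ 2)) ≤
      U * (5 * (3 * √(lam * L) + 6 * (d * G * D * L))) := by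
    gcongr
  rw [hlead] at h1 h2
  linarith only [hR, h1, h2, hN0, p1, p2, p3]

/-- The trade-off between the trivial bound and the bound for a fixed learning rate. Here `R` is an
expected regret, `lam = G² κ D τ` the order of the expected lag, and `L` the logarithmic factor. -/
lemma regret_le_of_rates {R N D d G U τ κ L a Z : ℝ} (hN : 1 ≤ N) (hD : 1 ≤ D) (hd : 1 ≤ d)
    (hG : 0 < G) (hU : 0 ≤ U) (hτ : 0 ≤ τ) (hκ : 1 ≤ κ) (hκd : κ ≤ 1 + d)
    (hL : L = Real.log (1 + N * D * U * τ * G)) (ha : a = 1 / (2 * d * G * 20 * (1 + 2 * D)))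
    (hZ0 : 0 ≤ Z) (hZa : Z ≤ a) (hZ1 : Z ≤ 1)
    (htriv : R ≤ 1 / N + U * G * τ)
    (hrate : 0 < U → ∀ η₀ M : ℝ, 0 < η₀ → η₀ ≤ a → 0 ≤ M →
      4 * U * Z ≤ 1 / N * η₀ ^ 2 * Real.exp M →
      R ≤ 1 / N + 2 * U / η₀ * (M + η₀ ^ 2 * (8 * (G ^ 2 * κ * D * τ) + 1)) +
        U * (5 * √(8 * (G ^ 2 * κ * D * τ) + (2 * d * G) ^ 2 * (2 * D + 1) ^ 2))) :
    R ≤ 2000 * (1 / N + (U * G * √(κ * D * τ * L) + U * (√L + d * G * D * L))) := by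
  have hx : 0 ≤ N * D * U * τ * G := by positivity
  have hL0 : 0 ≤ L := by rw [hL]; exact Real.log_nonneg (by linarith)
  have hexp : Real.exp L = 1 + N * D * U * τ * G := by rw [hL, Real.exp_log (by linarith)]
  have hN0 : 0 < 1 / N := by positivity
  have p1 : 0 ≤ U * G * √(κ * D * τ * L) := by positivity
  have p2 : 0 ≤ U * √L := by positivity
  have p3 : 0 ≤ U * (d * G * D * L) := by positivity
  rcases lt_or_ge L 1 with hL1 | hL1
  · -- a small logarithm means that the trivial bound is of order `1 / N`
    have h1 : N * D * U * τ * G ≤ 2 := by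
      have := Real.exp_lt_exp.2 hL1
      have := Real.exp_one_lt_d9
      linarith
    have h2 : N * (U * G * τ) ≤ 2 := by
      refine le_trans ?_ h1
      have : 0 ≤ N * (U * G * τ) := by positivity
      nlinarith
    have h3 : U * G * τ ≤ 2 * (1 / N) := by
      rw [mul_one_div, le_div_iff₀ (by linarith)]
      linarith
    linarith
  rcases le_or_gt τ (d * D) with hτ1 | hτ1
  · have h1 : U * G * τ ≤ U * (d * G * D * L) := by
      calc U * G * τ ≤ U * G * (d * D) := by gcongr
        _ = U * (d * G * D * 1) := by ring
        _ ≤ _ := by gcongr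
    linarith
  rcases le_or_gt (G * τ) 1 with hτ2 | hτ2
  · have h1 : U * G * τ ≤ U * √L := by
      rw [mul_assoc]
      gcongr
      exact hτ2.trans (Real.one_le_sqrt.2 hL1)
    linarith
  rcases hU.eq_or_lt with rfl | hU0
  · simp only [zero_mul, add_zero] at htriv ⊢
    linarith
  exact regret_le_of_balanced_rate hN hD hd hG hU0 hτ hκ hκd hexp hL1 ha hZ0 hZa hZ1 hτ1 hτ2
    (hrate hU0)

section Cell

variable {V : Type*} {𝒢 : SimpleGraph V} {T d b : ℕ} {Q : Finset 𝒢.Subgraph} {G : ℝ}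
  {A : Adversary V d (repetitions Q b d) T}

/-- The expected regret of the copy of the algorithm on one cell of the partition. -/
lemma Adversary.Valid.expect_linearRegret_le_cell [Finite V] (hA : A.Valid Q G) (hG : 0 < G)
    (hd : 1 ≤ d) (hb : maxDiameter Q * symbolBits d ≤ b) {F : 𝒢.Subgraph} (hFQ : F ∈ Q)
    (hF : F.Connected) (u : Vec d) :
    A.expect G (A.linearRegret Q G F u A.grad) ≤ 2000 * (1 / (Q.card : ℝ) +
      (leadingTerm Q b d F G ‖u‖ (A.expect G (A.cellRounds F)) +
        lowerOrderTerm Q d F G ‖u‖ (A.expect G (A.cellRounds F)))) := by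
  have hD : 1 ≤ diameter F := one_le_diameter F
  have hDQ : 0 < maxDiameter Q := lt_of_lt_of_le hD (Adversary.diameter_le_maxDiameter hFQ)
  have hm := one_le_repetitions hDQ hb
  have hdm := div_repetitions_le hDQ hb
  have hτ := hA.expect_cellRounds_nonneg hG hd F
  set τ := A.expect G (A.cellRounds F) with hτdef
  have hb0 : (0 : ℝ) < b := by
    have hs : 0 < symbolBits d := by unfold symbolBits; omega
    exact_mod_cast lt_of_lt_of_le (Nat.mul_pos hDQ hs) hb
  have hκd : (d : ℝ) * symbolBits d * maxDiameter Q / b ≤ d := by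
    rw [div_le_iff₀ hb0]
    have : ((maxDiameter Q * symbolBits d : ℕ) : ℝ) ≤ b := by exact_mod_cast hb
    push_cast at this
    nlinarith [mul_le_mul_of_nonneg_left this (Nat.cast_nonneg (α := ℝ) d)]
  set x := (d : ℝ) * symbolBits d * maxDiameter Q / b with hx
  have hx0 : 0 ≤ x := by positivity
  have hDr : (1 : ℝ) ≤ diameter F := by exact_mod_cast hD
  have hdr : (1 : ℝ) ≤ d := by exact_mod_cast hd
  have he : 0 < priorEnd F (2 * (d : ℝ) * G) := priorEnd_pos F (by positivity)
  refine regret_le_of_rates (κ := 1 + x) (by exact_mod_cast Finset.card_pos.2 ⟨F, hFQ⟩)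
    hDr hdr hG (norm_nonneg u) hτ (by linarith) (by linarith) rfl rfl
    (integral_exp_neg_sq_pos he).le (integral_exp_neg_sq_le_self he) (integral_exp_neg_sq_le_one he)
    (hA.expect_linearRegret_le_trivial hG hd hm hFQ hF u) ?_
  intro hU η₀ M hη₀ hη₀e hM hUM
  refine hA.expect_linearRegret_le hG hd hm hFQ hF (norm_pos_iff.1 hU) hη₀ hη₀e hM hUM ?_
  have h1 : G ^ 2 * (1 + 5 / 4 * ((d : ℝ) / repetitions Q b d)) ≤ G ^ 2 * (5 / 2 * (1 + x)) := by
    gcongr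
    linarith
  calc _ ≤ (3 * (diameter F : ℝ)) * (G ^ 2 * (5 / 2 * (1 + x)) * τ) := by
        gcongr
        linarith
    _ = 15 / 2 * (G ^ 2 * (1 + x) * diameter F * τ) := by ring
    _ ≤ _ := by
        have : 0 ≤ G ^ 2 * (1 + x) * diameter F * τ := by positivity
        linarith

lemma leadingTerm_nonneg (hG : 0 < G) (F : 𝒢.Subgraph) {normU τ : ℝ} (hU : 0 ≤ normU) :
    0 ≤ leadingTerm Q b d F G normU τ := by
  unfold leadingTerm; positivity

/-- Under the side conditions the leading term dominates. -/
lemma lowerOrderTerm_le (hG : 0 < G) (F : 𝒢.Subgraph) {normU τ : ℝ} (hU : 0 ≤ normU)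
    (hτ1 : 1 ≤ G ^ 2 * τ)
    (hτ2 : (d : ℝ) ^ 2 * diameter F * logFactor Q F G normU τ ≤ τ) :
    lowerOrderTerm Q d F G normU τ ≤ 2 * leadingTerm Q b d F G normU τ := by
  have hτ0 : 0 < τ := by
    by_contra! h
    nlinarith [sq_nonneg G]
  have hD : (1 : ℝ) ≤ diameter F := by exact_mod_cast one_le_diameter F
  have hL : 0 ≤ logFactor Q F G normU τ := by
    refine Real.log_nonneg ?_
    have : 0 ≤ (Q.card : ℝ) * diameter F * normU * τ * G := by positivity
    linarith
  unfold lowerOrderTerm leadingTerm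
  set L := logFactor Q F G normU τ
  set x := (d : ℝ) * symbolBits d * maxDiameter Q / b with hx
  have hx0 : 0 ≤ x := by positivity
  have hbase : (diameter F : ℝ) * τ * L ≤ (1 + x) * diameter F * τ * L := by
    have : 0 ≤ x * ((diameter F : ℝ) * τ * L) := by positivity
    linarith
  have e : G * √((1 + x) * diameter F * τ * L) = √(G ^ 2 * ((1 + x) * diameter F * τ * L)) := by
    rw [Real.sqrt_mul (sq_nonneg G), Real.sqrt_sq hG.le]
  have h1 : √L ≤ G * √((1 + x) * diameter F * τ * L) := by
    rw [e]
    refine Real.sqrt_le_sqrt ?_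
    calc L = 1 * (1 * L) := by ring
      _ ≤ (G ^ 2 * τ) * (diameter F * L) := by gcongr
      _ = G ^ 2 * (diameter F * τ * L) := by ring
      _ ≤ _ := by gcongr
  have h2 : d * G * diameter F * L ≤ G * √((1 + x) * diameter F * τ * L) := by
    have h3 : (d : ℝ) * diameter F * L ≤ √((1 + x) * diameter F * τ * L) := by
      refine Real.le_sqrt_of_sq_le ?_
      refine le_trans ?_ hbase
      have := mul_le_mul_of_nonneg_left hτ2 (by positivity : 0 ≤ (diameter F : ℝ) * L)
      linarith
    have := mul_le_mul_of_nonneg_left h3 hG.le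
    linarith
  calc normU * (√L + d * G * diameter F * L) ≤
      normU * (G * √((1 + x) * diameter F * τ * L) + G * √((1 + x) * diameter F * τ * L)) := by
        gcongr
    _ = _ := by ring

lemma Adversary.IsPartition.injective {r : ℕ} {F : Fin r → 𝒢.Subgraph}
    (hF : A.IsPartition Q F) (hQ : ∀ F ∈ Q, F.Connected) : Function.Injective F := by
  intro i j hij
  by_contra hne
  have h1 := hF.disjoint i j hne
  obtain ⟨x⟩ : Nonempty (F j).verts := (hQ _ (hF.mem j)).coe.nonempty
  exact Set.disjoint_left.1 h1 (by rw [hij]; exact x.2) x.2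

/-- The expected regret over a partition. The `|Q|` contributions `1 / |Q|` add up to one. -/
lemma Adversary.Valid.expect_sum_cellRegret_le_bound [Finite V] (hA : A.Valid Q G) (hG : 0 < G)
    (hQ : ∀ F ∈ Q, F.Connected) (hd : 1 ≤ d) (hb : maxDiameter Q * symbolBits d ≤ b) {r : ℕ}
    {F : Fin r → 𝒢.Subgraph} (hF : A.IsPartition Q F) (u : Fin r → Vec d) :
    A.expect G (fun h => ∑ j, A.cellRegret Q G (F j) (u j) h) ≤ 2000 * (1 +
      ∑ j, (leadingTerm Q b d (F j) G ‖u j‖ (A.expect G (A.cellRounds (F j))) +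
        lowerOrderTerm Q d (F j) G ‖u j‖ (A.expect G (A.cellRounds (F j))))) := by
  classical
  have hinj := hF.injective hQ
  refine (hA.expect_sum_cellRegret_le hG hd hF hinj u).trans ?_
  have h1 : ∑ F' ∈ Q \ Finset.univ.image F, A.expect G (A.linearRegret Q G F' 0 A.grad) ≤
      ∑ F' ∈ Q \ Finset.univ.image F, 2000 * (1 / (Q.card : ℝ)) := by
    refine Finset.sum_le_sum fun F' hF' => ?_
    have hFQ := (Finset.mem_sdiff.1 hF').1
    have hDQ : 0 < maxDiameter Q :=
      lt_of_lt_of_le (one_le_diameter F') (Adversary.diameter_le_maxDiameter hFQ)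
    have h2 := hA.expect_linearRegret_zero_le hG hd (one_le_repetitions hDQ hb) hFQ (hQ _ hFQ)
    have : 0 ≤ 1 / (Q.card : ℝ) := by positivity
    linarith
  have h2 := Finset.sum_le_sum fun j (_ : j ∈ Finset.univ) =>
    hA.expect_linearRegret_le_cell hG hd hb (hF.mem j) (hQ _ (hF.mem j)) (u j)
  have h3 : ∑ _j : Fin r, 2000 * (1 / (Q.card : ℝ)) =
      ∑ F' ∈ Finset.univ.image F, 2000 * (1 / (Q.card : ℝ)) := by
    rw [Finset.sum_image fun i _ j _ hij => hinj hij]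
  have h4 : ∑ F' ∈ Q \ Finset.univ.image F, 2000 * (1 / (Q.card : ℝ)) +
      ∑ F' ∈ Finset.univ.image F, 2000 * (1 / (Q.card : ℝ)) ≤ 2000 := by
    rw [Finset.sum_sdiff (Finset.image_subset_iff.2 fun j _ => hF.mem j), Finset.sum_const,
      nsmul_eq_mul]
    rcases Nat.eq_zero_or_pos Q.card with h | h
    · simp [h]
    · have : (Q.card : ℝ) ≠ 0 := by positivity
      field_simp
      exact le_rfl
  rw [Finset.sum_congr rfl fun j _ => mul_add (2000 : ℝ) _ _, Finset.sum_add_distrib, h3,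
    ← Finset.mul_sum Finset.univ _ (2000 : ℝ)] at h2
  linarith

end Cell

end DOCO

theorem mainTheorem2 :
    ∃ C : ℝ, 0 < C ∧
      ∀ (V : Type*) [Finite V] (𝒢 : SimpleGraph V) (Q : Finset 𝒢.Subgraph)
        (_hQ : ∀ F ∈ Q, F.Connected)
        (d b T : ℕ) (_hd : 1 ≤ d)
        (_hb : DOCO.maxDiameter Q * (3 * Nat.clog 2 d + 2) ≤ b)
        (G : ℝ) (_hG : 0 < G)
        (A : DOCO.Adversary V d (DOCO.repetitions Q b d) T) (_hA : A.Valid Q G),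
        -- a codeword fits into `⌊b / D_Q⌋` bits, and no node ever sends more than `b` bits
        Fintype.card (DOCO.Codeword d (DOCO.repetitions Q b d)) ≤
            2 ^ DOCO.bitsPerGradient Q b ∧
        (∀ h n t, (DOCO.forwarded Q (A.agent h) n t).card * DOCO.bitsPerGradient Q b ≤ b) ∧
        -- the regret bound
        ∀ (r : ℕ) (F : Fin r → 𝒢.Subgraph) (_hF : A.IsPartition Q F) (u : Fin r → DOCO.Vec d)
          (τ : Fin r → ℝ) (_hτ : ∀ j, τ j = A.expect G (A.cellRounds (F j))),
          A.expect G (fun h => ∑ j, A.cellRegret Q G (F j) (u j) h) ≤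
            C * (1 + ∑ j, (DOCO.leadingTerm Q b d (F j) G ‖u j‖ (τ j) +
              DOCO.lowerOrderTerm Q d (F j) G ‖u j‖ (τ j))) ∧
          ((∀ j, u j ≠ 0 → 1 ≤ G ^ 2 * τ j ∧
              (d : ℝ) ^ 2 * DOCO.diameter (F j) * DOCO.logFactor Q (F j) G ‖u j‖ (τ j) ≤ τ j) →
            A.expect G (fun h => ∑ j, A.cellRegret Q G (F j) (u j) h) ≤
              C * (1 + ∑ j, DOCO.leadingTerm Q b d (F j) G ‖u j‖ (τ j))) := by
  refine ⟨6000, by norm_num, ?_⟩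
  intro V _ 𝒢 Q hQ d b T hd hb G hG A hA
  refine ⟨DOCO.card_codeword_le (Nat.div_mul_le_self _ _),
    fun h n t => DOCO.card_forwarded_mul_le Q b _ n t, ?_⟩
  intro r F hF u τ hτ
  obtain rfl : τ = fun j => A.expect G (A.cellRounds (F j)) := funext hτ
  have h := hA.expect_sum_cellRegret_le_bound hG hQ hd hb hF u
  have hlead : ∀ j, 0 ≤ DOCO.leadingTerm Q b d (F j) G ‖u j‖ (A.expect G (A.cellRounds (F j))) :=
    fun j => DOCO.leadingTerm_nonneg hG (F j) (norm_nonneg _)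
  have hlow : ∀ j, 0 ≤ DOCO.lowerOrderTerm Q d (F j) G ‖u j‖ (A.expect G (A.cellRounds (F j))) := by
    intro j
    have hτ0 := hA.expect_cellRounds_nonneg hG hd (F j)
    have : 0 ≤ DOCO.logFactor Q (F j) G ‖u j‖ (A.expect G (A.cellRounds (F j))) := by
      refine Real.log_nonneg ?_
      have : 0 ≤ (Q.card : ℝ) * DOCO.diameter (F j) * ‖u j‖ *
        A.expect G (A.cellRounds (F j)) * G := by positivity
      linarith
    unfold DOCO.lowerOrderTerm
    positivity
  refine ⟨?_, fun hside => ?_⟩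
  · refine h.trans ?_
    have h1 := Finset.sum_nonneg fun j (_ : j ∈ Finset.univ) => add_nonneg (hlead j) (hlow j)
    linarith
  · have h1 : ∀ j, DOCO.leadingTerm Q b d (F j) G ‖u j‖ (A.expect G (A.cellRounds (F j))) +
        DOCO.lowerOrderTerm Q d (F j) G ‖u j‖ (A.expect G (A.cellRounds (F j))) ≤
        3 * DOCO.leadingTerm Q b d (F j) G ‖u j‖ (A.expect G (A.cellRounds (F j))) := by
      intro j
      by_cases hu : u j = 0
      · simp [hu, DOCO.leadingTerm, DOCO.lowerOrderTerm]
      · have h2 := DOCO.lowerOrderTerm_le (b := b) hG (F j) (norm_nonneg (u j)) (hside j hu).1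
          (hside j hu).2
        linarith
    have h2 := Finset.sum_le_sum fun j (_ : j ∈ Finset.univ) => h1 j
    rw [← Finset.mul_sum] at h2
    linarith
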